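/- An election consists of $m\ge 1$ candidates and an ordered list $(v_1,\dots,v_n)$ of $n\ge 1$ voters, each with a linear order over the candidates; $\mathrm{pos}_v(c)\in[m]$ is the position of $c$ in the order of $v$ (position $1$ is the best). It is single-crossing if for all candidates $a,b$ such that $v_1$ prefers $a$ to $b$ there is $t\in[n]$ such that the voters who prefer $a$ to $b$ are exactly $v_1,\dots,v_t$. A dissatisfaction function for $m$ candidates is a nondecreasing $\alpha^m\colon[m]\to\mathbb N$ with $\alpha^m(1)=0$; a family $\alpha=(\alpha^m)_{m\ge1}$ is polynomial-time computable if $\alpha^m(i)$ can be computed from $m$ and $i$ in time polynomial in $m$. For a positive integer $k$, a $k$-CC assignment is a map $\Phi$ from the voters to the candidates with at most $k$ values. It is optimal under $\alpha$-$\ell$-CC if it minimizes $\ell(\Phi)$ among all $k$-CC assignments, where $\ell_1(\Phi)=\sum_{i=1}^n\alpha^m(\mathrm{pos}_{v_i}(\Phi(v_i)))$ and $\ell_\infty(\Phi)=\max_{1\le i\le n}\alpha^m(\mathrm{pos}_{v_i}(\Phi(v_i)))$. Theorem. Let $\ell\in\{\ell_1,\ell_\infty\}$. For every polynomial-time computable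 family $\alpha$ of dissatisfaction functions there is an algorithm that, given a single-crossing election and a positive integer $k$, finds an optimal $k$-CC assignment under $\alpha$-$\ell$-CC in time polynomial in the length of the input. Apart from a time polynomial in $m$ for evaluating $\alpha^m$, it takes $O(mn^2k)$ steps on a unit-cost random access machine (whose arithmetic consists of addition and subtraction). If the $m$ values of an arbitrary dissatisfaction function $\alpha^m$ are given as part of the input, then such an assignment can be found in $O(mn^2k)$ steps, by one algorithm that does not depend on $\alpha^m$ and with an absolute constant. -/

import Mathlib

namespace SCElection

/-! ### Random access machines with unit cost

A machine has registers `reg 0, reg 1, …` and arrays `arr 0, arr 1, …` of natural numbers; a program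
mentions finitely many of them. The only arithmetic is addition and (truncated) subtraction, so
that numbers grow by at most one bit per step and unit-cost time is polynomially related to
Turing machine time. -/

/-- The memory of a machine. -/
structure Mem where
  reg : ℕ → ℕ
  arr : ℕ → ℕ → ℕ

/-- Write the value `v` into register `x`. -/
def Mem.setReg (s : Mem) (x v : ℕ) : Mem :=
  { s with reg := Function.update s.reg x v }

/-- Write the value `v` into cell `i` of array `a`. -/
def Mem.setArr (s : Mem) (a i v : ℕ) : Mem :=
  { s with arr := Function.update s.arr a (Function.update (s.arr a) i v) }

/-- Programs: assignments, array access through registers, tests `reg x < reg y`, loops. -/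
inductive Program : Type
  /-- do nothing -/
  | skip : Program
  /-- `reg x := c` -/
  | const (x c : ℕ) : Program
  /-- `reg x := reg y + reg z` -/
  | add (x y z : ℕ) : Program
  /-- `reg x := reg y - reg z` (zero if negative) -/
  | sub (x y z : ℕ) : Program
  /-- `reg x := arr a [reg y]` -/
  | load (x a y : ℕ) : Program
  /-- `arr a [reg x] := reg y` -/
  | store (a x y : ℕ) : Program
  /-- first `P`, then `Q` -/
  | seq (P Q : Program) : Program
  /-- if `reg x < reg y` then `P` else `Q` -/
  | ifLT (x y : ℕ) (P Q : Program) : Program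
  /-- while `reg x < reg y` do `P` -/
  | whileLT (x y : ℕ) (P : Program) : Program

/-- `Exec P s s' t`: started in memory `s`, the program `P` halts in memory `s'` after exactly `t`
steps. Every elementary instruction and every evaluation of a test is one step. -/
inductive Exec : Program → Mem → Mem → ℕ → Prop
  | skip (s : Mem) : Exec .skip s s 1
  | const (s : Mem) (x c : ℕ) : Exec (.const x c) s (s.setReg x c) 1
  | add (s : Mem) (x y z : ℕ) : Exec (.add x y z) s (s.setReg x (s.reg y + s.reg z)) 1
  | sub (s : Mem) (x y z : ℕ) : Exec (.sub x y z) s (s.setReg x (s.reg y - s.reg z)) 1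
  | load (s : Mem) (x a y : ℕ) : Exec (.load x a y) s (s.setReg x (s.arr a (s.reg y))) 1
  | store (s : Mem) (a x y : ℕ) : Exec (.store a x y) s (s.setArr a (s.reg x) (s.reg y)) 1
  | seq {P Q : Program} {s s' s'' : Mem} {t u : ℕ} (hP : Exec P s s' t) (hQ : Exec Q s' s'' u) :
      Exec (.seq P Q) s s'' (t + u)
  | ifTrue {x y : ℕ} {P Q : Program} {s s' : Mem} {t : ℕ} (h : s.reg x < s.reg y)
      (hP : Exec P s s' t) : Exec (.ifLT x y P Q) s s' (t + 1)
  | ifFalse {x y : ℕ} {P Q : Program} {s s' : Mem} {t : ℕ} (h : ¬ s.reg x < s.reg y)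
      (hQ : Exec Q s s' t) : Exec (.ifLT x y P Q) s s' (t + 1)
  | whileTrue {x y : ℕ} {P : Program} {s s' s'' : Mem} {t u : ℕ} (h : s.reg x < s.reg y)
      (hP : Exec P s s' t) (hW : Exec (.whileLT x y P) s' s'' u) :
      Exec (.whileLT x y P) s s'' (t + u + 1)
  | whileFalse {x y : ℕ} {P : Program} {s : Mem} (h : ¬ s.reg x < s.reg y) :
      Exec (.whileLT x y P) s s 1

/-- The initial memory: the input words are in array `0`, their number is in register `0`, and
everything else is zero. -/
def Mem.init (input : List ℕ) : Mem where
  reg x := if x = 0 then input.length else 0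
  arr a i := if a = 0 then input.getD i 0 else 0

/-- The output: register `1` holds its length, array `1` its words. -/
def Mem.output (s : Mem) : List ℕ :=
  (List.range (s.reg 1)).map (s.arr 1)

/-- On the given input, `P` halts after exactly `t` steps with the given output. -/
def Program.Outputs (P : Program) (input output : List ℕ) (t : ℕ) : Prop :=
  ∃ s : Mem, Exec P (Mem.init input) s t ∧ s.output = output

/-- The length of an input in bits (each word in binary, followed by a separator). -/
def bitLength (input : List ℕ) : ℕ :=
  (input.map fun w => w.size + 1).sum

/-! ### Elections -/

/-- An election with candidates `0, …, m - 1` and the ordered list of voters `0, …, n - 1`;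
`vote i r` is the candidate that voter `i` ranks in position `r`, where positions are numbered
from `0` (the most preferred candidate) to `m - 1`. -/
structure Election where
  m : ℕ
  n : ℕ
  m_pos : 0 < m
  n_pos : 0 < n
  vote : Fin n → Equiv.Perm (Fin m)

/-- The position of candidate `c` in the preference order of voter `i`, counted from `0`. -/
def Election.pos (E : Election) (i : Fin E.n) (c : Fin E.m) : Fin E.m :=
  (E.vote i).symm c

/-- Voter `i` prefers candidate `a` to candidate `b`. -/
def Election.Prefers (E : Election) (i : Fin E.n) (a b : Fin E.m) : Prop :=
  E.pos i a < E.pos i b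

/-- The election is single-crossing with respect to the given order of the voters: for all
candidates `a`, `b` such that the first voter prefers `a` to `b`, the voters who prefer `a` to `b`
are exactly the first `t` voters, for some `1 ≤ t ≤ n`. -/
def Election.SingleCrossing (E : Election) : Prop :=
  ∀ a b : Fin E.m, E.Prefers ⟨0, E.n_pos⟩ a b →
    ∃ t : ℕ, 1 ≤ t ∧ t ≤ E.n ∧ ∀ i : Fin E.n, E.Prefers i a b ↔ (i : ℕ) < t

/-- Dissatisfaction functions for `m` candidates: nondecreasing, and `0` at the top position. -/
def IsDissatisfaction {m : ℕ} (α : Fin m → ℕ) : Prop :=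
  Monotone α ∧ ∀ i : Fin m, (i : ℕ) = 0 → α i = 0

/-- A family of functions `α m` of the position is polynomial-time computable if one program
computes `α m i` from `m` and `i`, in time polynomial in `m`. -/
def PolyTimeFamily (α : (m : ℕ) → Fin m → ℕ) : Prop :=
  ∃ (P : Program) (p : Polynomial ℕ), ∀ (m : ℕ) (i : Fin m),
    ∃ t ≤ p.eval m, P.Outputs [m, i] [α m i] t

/-- The two ways of aggregating the dissatisfactions of the voters. -/
inductive Aggregation : Type
  /-- the sum -/
  | l1 : Aggregation
  /-- the maximum -/
  | linf : Aggregation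

/-- Aggregation of a vector of natural numbers. -/
def Aggregation.eval : Aggregation → {n : ℕ} → (Fin n → ℕ) → ℕ
  | .l1, _, f => ∑ i, f i
  | .linf, _, f => Finset.univ.sup f

/-- `k`-CC-assignments: assignments of candidates to voters with at most `k` values. -/
def Election.IsCCAssignment (E : Election) (k : ℕ) (Φ : Fin E.n → Fin E.m) : Prop :=
  (Finset.univ.image Φ).card ≤ k

/-- The aggregated dissatisfaction `ℓ(Φ)` of an assignment. -/
def Election.dissatisfaction (E : Election) (α : Fin E.m → ℕ) (ℓ : Aggregation)
    (Φ : Fin E.n → Fin E.m) : ℕ :=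
  ℓ.eval fun i => α (E.pos i (Φ i))

/-- Optimal `k`-CC-assignments under `α`-`ℓ`-CC. -/
def Election.IsOptimalCC (E : Election) (α : Fin E.m → ℕ) (ℓ : Aggregation) (k : ℕ)
    (Φ : Fin E.n → Fin E.m) : Prop :=
  E.IsCCAssignment k Φ ∧
    ∀ Ψ : Fin E.n → Fin E.m, E.IsCCAssignment k Ψ →
      E.dissatisfaction α ℓ Φ ≤ E.dissatisfaction α ℓ Ψ

/-! ### Encodings as lists of words -/

/-- The preference orders, voter by voter, each listed from the best to the worst candidate. -/
def Election.encodeVotes (E : Election) : List ℕ :=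
  (List.ofFn fun i => List.ofFn fun r => (E.vote i r : ℕ)).flatten

/-- The input consisting of an election and `k`. -/
def Election.encode (E : Election) (k : ℕ) : List ℕ :=
  [E.m, E.n, k] ++ E.encodeVotes

/-- The input consisting of an election, `k`, and the values of a dissatisfaction function. -/
def Election.encodeWith (E : Election) (α : Fin E.m → ℕ) (k : ℕ) : List ℕ :=
  [E.m, E.n, k] ++ List.ofFn α ++ E.encodeVotes

/-- An assignment as the list of the candidates assigned to the voters. -/
def encodeAssignment {n m : ℕ} (Φ : Fin n → Fin m) : List ℕ :=
  List.ofFn fun i => (Φ i : ℕ)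

end SCElection

/-! Within a committee, every voter may be assigned her favourite candidate. Since the election is
single-crossing, the position of this favourite in the order of the first voter can only increase
along the list of voters: if a later voter prefers a candidate whom the first voter ranks higher,
then so do all voters before her. Hence an optimal assignment changes its candidate at most
`min k n - 1` times, and the converse bound on the number of candidates is clear. Assignments with
at most `t` changes are optimized by a dynamic program over the voters `i`, the number `t` of
changes and the current candidate `c`: as a change may go to any candidate, only the best entry of
the preceding layer `(i, t - 1)` matters, so that each of the `m n min k n` entries takes constant
time. A polynomial-time family is tabulated beforehand, by simulating its program inside the memory
of the machine, at fresh addresses for each argument so that nothing has to be erased. -/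

namespace SCElection

/-! ### The dynamic program -/

/-- The binary operation that an aggregation iterates over the voters. -/
def Aggregation.op : Aggregation → ℕ → ℕ → ℕ
  | .l1, a, b => a + b
  | .linf, a, b => max a b

/-- Aggregation of the first `i` terms of a sequence. -/
def Aggregation.accum (ℓ : Aggregation) (u : ℕ → ℕ) : ℕ → ℕ
  | 0 => 0
  | i + 1 => ℓ.op (ℓ.accum u i) (u i)

theorem Aggregation.op_le_op_right (ℓ : Aggregation) {a a' : ℕ} (h : a ≤ a') (b : ℕ) :
    ℓ.op a b ≤ ℓ.op a' b := by
  cases ℓ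
  · exact Nat.add_le_add_right h b
  · exact max_le_max_right b h

theorem Aggregation.accum_congr (ℓ : Aggregation) {u v : ℕ → ℕ} {n : ℕ}
    (h : ∀ i < n, u i = v i) : ℓ.accum u n = ℓ.accum v n := by
  induction n with
  | zero => rfl
  | succ n ih => rw [accum, accum, ih fun i hi => h i (hi.trans n.lt_succ_self), h n n.lt_succ_self]

theorem Aggregation.eval_eq_accum (ℓ : Aggregation) (u : ℕ → ℕ) (n : ℕ) :
    (ℓ.eval fun i : Fin n => u i) = ℓ.accum u n := by
  induction n with
  | zero => cases ℓ <;> rfl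
  | succ n ih =>
    rw [accum, ← ih]
    cases ℓ
    · exact Fin.sum_univ_castSucc fun i : Fin (n + 1) => u i
    · simp only [eval, op, Fin.univ_castSuccEmb, Finset.sup_cons, Finset.sup_map, Function.comp_def,
        Fin.val_last, Fin.coe_castSuccEmb, Fin.val_castSucc]
      exact max_comm _ _

theorem Aggregation.eval_mono (ℓ : Aggregation) {n : ℕ} {f g : Fin n → ℕ} (h : f ≤ g) :
    ℓ.eval f ≤ ℓ.eval g := by
  cases ℓ
  · exact Finset.sum_le_sum fun i _ => h i
  · exact Finset.sup_mono_fun fun i _ => h i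

/-- The first minimizer of `g` on `{0, …, c - 1}`, as found by a linear scan; `0` if `c = 0`. -/
def argminBelow (g : ℕ → ℕ) : ℕ → ℕ
  | 0 => 0
  | c + 1 => if g c < g (argminBelow g c) then c else argminBelow g c

theorem argminBelow_le (g : ℕ → ℕ) (c : ℕ) : argminBelow g c ≤ c := by
  induction c with
  | zero => exact le_rfl
  | succ c ih => rw [argminBelow]; split_ifs <;> omega

theorem argminBelow_lt (g : ℕ → ℕ) {c : ℕ} (hc : 0 < c) : argminBelow g c < c := by
  obtain ⟨c, rfl⟩ := Nat.exists_eq_add_one.2 hc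
  have := argminBelow_le g c
  rw [argminBelow]
  split_ifs <;> omega

theorem apply_argminBelow_le (g : ℕ → ℕ) {b c : ℕ} (hb : b < c) : g (argminBelow g c) ≤ g b := by
  induction c with
  | zero => omega
  | succ c ih =>
    rw [argminBelow]
    rcases Nat.lt_succ_iff_lt_or_eq.1 hb with hb | rfl
    · have := ih hb
      split_ifs <;> omega
    · split_ifs <;> omega

/-- The state from which state `(t, c)` of the next voter is reached best, where `F` is the table
of the current voter: either `(t, c)` itself, or, with one change less available, the best
candidate of layer `t - 1`. -/
def dpPred (m : ℕ) (F : ℕ → ℕ → ℕ) (t c : ℕ) : ℕ × ℕ :=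
  if 0 < t ∧ F (t - 1) (argminBelow (F (t - 1)) m) < F t c then
    (t - 1, argminBelow (F (t - 1)) m) else (t, c)

/-- `dpTable ℓ m w i t c` is the least aggregated cost of the first `i` voters when the last of
them is assigned to `c` and the assignment changes at most `t` times. -/
def dpTable (ℓ : Aggregation) (m : ℕ) (w : ℕ → ℕ → ℕ) : ℕ → ℕ → ℕ → ℕ
  | 0, _, _ => 0
  | i + 1, t, c =>
    ℓ.op (dpTable ℓ m w i (dpPred m (dpTable ℓ m w i) t c).1
      (dpPred m (dpTable ℓ m w i) t c).2) (w i c)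

/-- The assignment of the first `i` voters found by following `dpPred` backwards. -/
def dpTrace (ℓ : Aggregation) (m : ℕ) (w : ℕ → ℕ → ℕ) : ℕ → ℕ → ℕ → ℕ → ℕ
  | 0, _, _ => fun _ => 0
  | i + 1, t, c =>
    Function.update (dpTrace ℓ m w i (dpPred m (dpTable ℓ m w i) t c).1
      (dpPred m (dpTable ℓ m w i) t c).2) i c

section dpPred

variable {m : ℕ} (F : ℕ → ℕ → ℕ) (t : ℕ) {b c : ℕ}

theorem dpPred_snd_lt (hc : c < m) : (dpPred m F t c).2 < m := by
  rw [dpPred]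
  split_ifs
  · exact argminBelow_lt _ (Nat.zero_lt_of_lt hc)
  · exact hc

theorem dpPred_fst_le : (dpPred m F t c).1 ≤ t := by
  rw [dpPred]
  split_ifs
  · exact Nat.sub_le _ _
  · exact le_rfl

theorem dpPred_fst_lt (h : (dpPred m F t c).2 ≠ c) : (dpPred m F t c).1 < t := by
  rw [dpPred] at h ⊢
  split_ifs at h ⊢ with hlt
  · exact Nat.sub_lt hlt.1 one_pos
  · exact absurd rfl h

theorem apply_dpPred_le_self : F (dpPred m F t c).1 (dpPred m F t c).2 ≤ F t c := by
  rw [dpPred]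
  split_ifs with hlt
  · exact hlt.2.le
  · exact le_rfl

theorem apply_dpPred_add_one_le (hb : b < m) :
    F (dpPred m F (t + 1) c).1 (dpPred m F (t + 1) c).2 ≤ F t b := by
  have hmin := apply_argminBelow_le (F t) hb
  rw [dpPred]
  split_ifs with hlt
  · exact hmin
  · simp only [Nat.succ_pos, Nat.add_sub_cancel, true_and, not_lt] at hlt
    exact hlt.trans hmin

end dpPred

/-- The number of changes in `g 0, …, g i`. -/
def changes {β : Type*} [DecidableEq β] (g : ℕ → β) : ℕ → ℕ
  | 0 => 0
  | i + 1 => changes g i + if g i = g (i + 1) then 0 else 1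

/-- A sequence that moves monotonically with respect to some ranking of its values never returns
to a value it has left. -/
theorem changes_lt_card_image {β γ : Type*} [DecidableEq β] [PartialOrder γ] {r : β → γ}
    (hr : Function.Injective r) {g : ℕ → β} (hg : Monotone (r ∘ g)) (i : ℕ) :
    changes g i < ((Finset.range (i + 1)).image g).card := by
  induction i with
  | zero => simp [changes]
  | succ i ih =>
    rw [changes, Finset.range_add_one, Finset.image_insert]
    split_ifs with h
    · exact ih.trans_le (Finset.card_le_card (Finset.subset_insert _ _))
    · have hnew : g (i + 1) ∉ (Finset.range (i + 1)).image g := by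
        simp only [Finset.mem_image, Finset.mem_range, not_exists, not_and]
        intro j hj hji
        refine h (hr (le_antisymm (hg i.le_succ) ?_))
        exact (congrArg r hji).ge.trans (hg (Nat.le_of_lt_succ hj))
      rw [Finset.card_insert_of_notMem hnew]
      omega

section dpTable

variable (ℓ : Aggregation) {m : ℕ} (w : ℕ → ℕ → ℕ) (i t : ℕ) {c : ℕ}

theorem dpTrace_lt (hc : c < m) (j : ℕ) : dpTrace ℓ m w i t c j < m := by
  induction i generalizing t c with
  | zero => exact Nat.zero_lt_of_lt hc
  | succ i ih =>
    rw [dpTrace, Function.update_apply]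
    split_ifs
    · exact hc
    · exact ih _ (dpPred_snd_lt _ _ hc)

theorem accum_dpTrace :
    ℓ.accum (fun j => w j (dpTrace ℓ m w i t c j)) i = dpTable ℓ m w i t c := by
  induction i generalizing t c with
  | zero => rfl
  | succ i ih =>
    rw [Aggregation.accum, dpTable, ← ih]
    congr 1
    · refine ℓ.accum_congr fun j hj => ?_
      rw [dpTrace, Function.update_of_ne hj.ne]
    · rw [dpTrace, Function.update_self]

theorem image_dpTrace_succ :
    (Finset.range (i + 1)).image (dpTrace ℓ m w (i + 1) t c) =
      insert c ((Finset.range i).image (dpTrace ℓ m w i (dpPred m (dpTable ℓ m w i) t c).1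
        (dpPred m (dpTable ℓ m w i) t c).2)) := by
  rw [Finset.range_add_one, Finset.image_insert, dpTrace, Function.update_self]
  congr 1
  refine Finset.image_congr fun j hj => Function.update_of_ne ?_ _ _
  exact (Finset.mem_range.1 (Finset.mem_coe.1 hj)).ne

theorem card_insert_image_dpTrace_le :
    (insert c ((Finset.range i).image (dpTrace ℓ m w i t c))).card ≤ t + 1 := by
  induction i generalizing t c with
  | zero => simp
  | succ i ih =>
    rw [image_dpTrace_succ, Finset.insert_idem]
    set p := dpPred m (dpTable ℓ m w i) t c
    have hcard := ih p.1 (c := p.2)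
    by_cases hpc : p.2 = c
    · rw [hpc] at hcard ⊢
      exact hcard.trans (Nat.succ_le_succ (dpPred_fst_le _ _))
    · have hlt : p.1 < t := dpPred_fst_lt _ _ hpc
      calc _ ≤ ((Finset.range i).image (dpTrace ℓ m w i p.1 p.2)).card + 1 :=
            Finset.card_insert_le _ _
        _ ≤ p.1 + 1 + 1 := by
            gcongr
            exact (Finset.card_le_card (Finset.subset_insert _ _)).trans hcard
        _ ≤ t + 1 := by omega

theorem dpTable_le_accum {g : ℕ → Fin m} (ht : changes g i ≤ t) :
    dpTable ℓ m w (i + 1) t (g i) ≤ ℓ.accum (fun j => w j (g j)) (i + 1) := by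
  induction i generalizing t with
  | zero => exact le_rfl
  | succ i ih =>
    rw [dpTable, Aggregation.accum]
    refine ℓ.op_le_op_right ?_ _
    rw [changes] at ht
    split_ifs at ht with h
    · refine (apply_dpPred_le_self _ _).trans ?_
      rw [← h]
      exact ih t ht
    · obtain ⟨t, rfl⟩ := Nat.exists_eq_add_one.2 (Nat.zero_lt_of_lt ht)
      exact (apply_dpPred_add_one_le _ t (g i).isLt).trans (ih t (Nat.le_of_succ_le_succ ht))

end dpTable

/-! ### Single-crossing elections -/

namespace Election

variable (E : Election) (α : Fin E.m → ℕ) (ℓ : Aggregation)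

/-- The dissatisfaction of voter `i` with candidate `c`, with junk value `0` out of range. -/
def cost (i c : ℕ) : ℕ :=
  if h : i < E.n ∧ c < E.m then α (E.pos ⟨i, h.1⟩ ⟨c, h.2⟩) else 0

/-- The assignment computed by the dynamic program when `t` changes are allowed. -/
def solution (t : ℕ) (i : Fin E.n) : Fin E.m :=
  ⟨dpTrace ℓ E.m (E.cost α) E.n t (argminBelow (dpTable ℓ E.m (E.cost α) E.n t) E.m) i,
    dpTrace_lt _ _ _ _ (argminBelow_lt _ E.m_pos) _⟩

variable {E}

theorem dissatisfaction_eq_accum {Φ : Fin E.n → Fin E.m} {g : ℕ → ℕ}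
    (hg : ∀ i, (Φ i : ℕ) = g i) :
    E.dissatisfaction α ℓ Φ = ℓ.accum (fun i => E.cost α i (g i)) E.n := by
  rw [← ℓ.eval_eq_accum, dissatisfaction]
  congr 1 with i
  rw [cost, dif_pos ⟨i.2, hg i ▸ (Φ i).2⟩]
  simp only [← hg]

theorem dissatisfaction_solution (t : ℕ) :
    E.dissatisfaction α ℓ (E.solution α ℓ t) =
      dpTable ℓ E.m (E.cost α) E.n t (argminBelow (dpTable ℓ E.m (E.cost α) E.n t) E.m) := by
  rw [dissatisfaction_eq_accum α ℓ fun _ => rfl, accum_dpTrace]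

theorem isCCAssignment_solution (t : ℕ) : E.IsCCAssignment (t + 1) (E.solution α ℓ t) := by
  let c := argminBelow (dpTable ℓ E.m (E.cost α) E.n t) E.m
  have himage : (Finset.univ.image (E.solution α ℓ t)).image Fin.val ⊆
      insert c ((Finset.range E.n).image (dpTrace ℓ E.m (E.cost α) E.n t c)) := by
    rw [Finset.image_image]
    refine Finset.Subset.trans (Finset.image_subset_iff.2 fun i _ => ?_) (Finset.subset_insert _ _)
    exact Finset.mem_image_of_mem _ (Finset.mem_range.2 i.2)
  rw [IsCCAssignment, ← Finset.card_image_of_injective _ Fin.val_injective]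
  exact (Finset.card_le_card himage).trans (card_insert_image_dpTrace_le _ _ _ _)

/-- Were `Φ j` ahead of `Φ i` for the first voter, then voter `j`, and hence also the earlier
voter `i`, would prefer `Φ j` to `Φ i`. -/
theorem SingleCrossing.monotone_favourite (hE : E.SingleCrossing) {Φ : Fin E.n → Fin E.m}
    (hΦ : ∀ i j, E.pos i (Φ i) ≤ E.pos i (Φ j)) :
    Monotone fun i => E.pos ⟨0, E.n_pos⟩ (Φ i) := by
  intro i j hij
  by_contra! hlt
  obtain ⟨t, -, -, ht⟩ := hE (Φ j) (Φ i) hlt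
  have hne : Φ j ≠ Φ i := fun h => hlt.ne (congrArg _ h)
  have hj : E.Prefers j (Φ j) (Φ i) := (hΦ j i).lt_of_ne ((E.vote j).symm.injective.ne hne)
  have hi : E.Prefers i (Φ j) (Φ i) := (ht i).2 ((Fin.le_def.1 hij).trans_lt ((ht j).1 hj))
  exact (hΦ i j).not_gt hi

theorem SingleCrossing.exists_monotone_favourite (hE : E.SingleCrossing) (Ψ : Fin E.n → Fin E.m) :
    ∃ Φ : Fin E.n → Fin E.m, Finset.univ.image Φ ⊆ Finset.univ.image Ψ ∧
      (∀ i, E.pos i (Φ i) ≤ E.pos i (Ψ i)) ∧ Monotone fun i => E.pos ⟨0, E.n_pos⟩ (Φ i) := by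
  have hmem : ∀ i, Ψ i ∈ Finset.univ.image Ψ := fun i =>
    Finset.mem_image_of_mem _ (Finset.mem_univ i)
  choose Φ hΦmem hΦ using fun i => Finset.exists_min_image _ (E.pos i) ⟨Ψ i, hmem i⟩
  exact ⟨Φ, Finset.image_subset_iff.2 fun i _ => hΦmem i, fun i => hΦ i _ (hmem i),
    hE.monotone_favourite fun i j => hΦ i _ (hΦmem j)⟩

theorem dissatisfaction_solution_le {t : ℕ} {Φ : Fin E.n → Fin E.m}
    (hΦ : Monotone fun i => E.pos ⟨0, E.n_pos⟩ (Φ i)) (ht : E.IsCCAssignment (t + 1) Φ) :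
    E.dissatisfaction α ℓ (E.solution α ℓ t) ≤ E.dissatisfaction α ℓ Φ := by
  obtain ⟨N, hN⟩ := Nat.exists_eq_add_one.2 E.n_pos
  -- The last voter is repeated forever.
  let clamp : ℕ → Fin E.n := fun i => ⟨min i N, by omega⟩
  let g : ℕ → Fin E.m := Φ ∘ clamp
  have hΦg : ∀ i : Fin E.n, (Φ i : ℕ) = g i := fun i => by
    have hi : clamp i = i := Fin.ext (min_eq_left (Nat.le_of_lt_succ (i.isLt.trans_eq hN)))
    simp only [g, Function.comp_apply, hi]
  have hclamp : Monotone clamp := fun i j hij => min_le_min_right N hij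
  have hchanges : changes g N ≤ t := by
    have himage : (Finset.range (N + 1)).image g ⊆ Finset.univ.image Φ :=
      Finset.image_subset_iff.2 fun i _ => Finset.mem_image_of_mem Φ (Finset.mem_univ _)
    have hlt := changes_lt_card_image (E.vote ⟨0, E.n_pos⟩).symm.injective (hΦ.comp hclamp) N
    exact Nat.le_of_lt_succ (hlt.trans_le ((Finset.card_le_card himage).trans ht))
  rw [dissatisfaction_solution, dissatisfaction_eq_accum α ℓ (g := fun i => g i) hΦg, hN]
  exact (apply_argminBelow_le _ (g N).isLt).trans (dpTable_le_accum ℓ _ N t hchanges)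

theorem SingleCrossing.isOptimalCC_solution (hE : E.SingleCrossing) {α : Fin E.m → ℕ}
    (hα : Monotone α) (ℓ : Aggregation) {k t : ℕ} (ht : min k E.n = t + 1) :
    E.IsOptimalCC α ℓ k (E.solution α ℓ t) := by
  refine ⟨(isCCAssignment_solution α ℓ t).trans (ht ▸ min_le_left _ _), fun Ψ hΨ => ?_⟩
  obtain ⟨Φ, himage, hpos, hmono⟩ := hE.exists_monotone_favourite Ψ
  have hcard : E.IsCCAssignment (t + 1) Φ :=
    ht ▸ le_min ((Finset.card_le_card himage).trans hΨ)
      (Finset.card_image_le.trans (Finset.card_fin _).le)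
  calc E.dissatisfaction α ℓ (E.solution α ℓ t) ≤ E.dissatisfaction α ℓ Φ :=
        dissatisfaction_solution_le α ℓ hmono hcard
    _ ≤ E.dissatisfaction α ℓ Ψ := ℓ.eval_mono fun i => hα (hpos i)

end Election

/-! ### Reasoning about programs -/

@[simp] theorem Mem.reg_setReg (s : Mem) (x v y : ℕ) :
    (s.setReg x v).reg y = if y = x then v else s.reg y :=
  Function.update_apply _ _ _ _

@[simp] theorem Mem.arr_setReg (s : Mem) (x v : ℕ) : (s.setReg x v).arr = s.arr := rfl

@[simp] theorem Mem.reg_setArr (s : Mem) (a i v : ℕ) : (s.setArr a i v).reg = s.reg := rfl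

@[simp] theorem Mem.arr_setArr (s : Mem) (a i v b : ℕ) :
    (s.setArr a i v).arr b = if b = a then Function.update (s.arr a) i v else s.arr b :=
  Function.update_apply _ _ _ _

namespace Program

/-- The registers that a program may write to. -/
def writes : Program → Finset ℕ
  | skip | store _ _ _ => ∅
  | const x _ | add x _ _ | sub x _ _ | load x _ _ => {x}
  | seq P Q | ifLT _ _ P Q => P.writes ∪ Q.writes
  | whileLT _ _ P => P.writes

/-- The arrays that a program may write to. -/
def stores : Program → Finset ℕ
  | skip | const _ _ | add _ _ _ | sub _ _ _ | load _ _ _ => ∅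
  | store a _ _ => {a}
  | seq P Q | ifLT _ _ P Q => P.stores ∪ Q.stores
  | whileLT _ _ P => P.stores

/-- The memories `s` and `s'` differ at most in the registers and arrays that `P` may write to. -/
structure Frame (P : Program) (s s' : Mem) : Prop where
  reg : ∀ x ∉ P.writes, s'.reg x = s.reg x
  arr : ∀ a ∉ P.stores, s'.arr a = s.arr a

theorem Frame.refl (P : Program) (s : Mem) : P.Frame s s :=
  ⟨fun _ _ => rfl, fun _ _ => rfl⟩

theorem Frame.trans {P : Program} {s s' s'' : Mem} (h : P.Frame s s') (h' : P.Frame s' s'') :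
    P.Frame s s'' :=
  ⟨fun x hx => (h'.reg x hx).trans (h.reg x hx), fun a ha => (h'.arr a ha).trans (h.arr a ha)⟩

theorem Frame.weaken {P Q : Program} {s s' : Mem} (h : P.Frame s s')
    (hw : P.writes ⊆ Q.writes) (hs : P.stores ⊆ Q.stores) : Q.Frame s s' :=
  ⟨fun x hx => h.reg x fun hxP => hx (hw hxP), fun a ha => h.arr a fun haP => ha (hs haP)⟩

theorem frame_setReg {P : Program} {x : ℕ} (hx : x ∈ P.writes) (s : Mem) (v : ℕ) :
    P.Frame s (s.setReg x v) :=
  ⟨fun _ hy => Function.update_of_ne (ne_of_mem_of_not_mem hx hy).symm _ _, fun _ _ => rfl⟩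

theorem frame_setArr {P : Program} {a : ℕ} (ha : a ∈ P.stores) (s : Mem) (i v : ℕ) :
    P.Frame s (s.setArr a i v) :=
  ⟨fun _ _ => rfl, fun _ hb => Function.update_of_ne (ne_of_mem_of_not_mem ha hb).symm _ _⟩

theorem frame_of_exec {P : Program} {s s' : Mem} {t : ℕ} (h : Exec P s s' t) : P.Frame s s' := by
  induction h with
  | skip s => exact .refl _ s
  | const | add | sub | load => exact frame_setReg (Finset.mem_singleton_self _) _ _
  | store => exact frame_setArr (Finset.mem_singleton_self _) _ _ _
  | seq _ _ ihP ihQ =>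
    exact (ihP.weaken Finset.subset_union_left Finset.subset_union_left).trans
      (ihQ.weaken Finset.subset_union_right Finset.subset_union_right)
  | ifTrue _ _ ih => exact ih.weaken Finset.subset_union_left Finset.subset_union_left
  | ifFalse _ _ ih => exact ih.weaken Finset.subset_union_right Finset.subset_union_right
  | whileTrue _ _ _ ihP ihW =>
    exact (ihP.weaken (Q := .whileLT _ _ _) subset_rfl subset_rfl).trans ihW
  | whileFalse => exact .refl _ _

/-- Started in `s`, the program halts within `B` steps, in a memory satisfying `Q`. -/
def Runs (P : Program) (s : Mem) (B : ℕ) (Q : Mem → Prop) : Prop :=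
  ∃ (s' : Mem) (t : ℕ), Exec P s s' t ∧ t ≤ B ∧ Q s'

theorem Runs.mono {P : Program} {s : Mem} {B B' : ℕ} {Q Q' : Mem → Prop} (h : P.Runs s B Q)
    (hB : B ≤ B') (hQ : ∀ s', P.Frame s s' → Q s' → Q' s') : P.Runs s B' Q' := by
  obtain ⟨s', t, hP, ht, hs'⟩ := h
  exact ⟨s', t, hP, ht.trans hB, hQ _ (frame_of_exec hP) hs'⟩

theorem Runs.seq {P P' : Program} {s : Mem} {B B' : ℕ} {Q R : Mem → Prop} (h : P.Runs s B Q)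
    (h' : ∀ s', P.Frame s s' → Q s' → P'.Runs s' B' R) : (seq P P').Runs s (B + B') R := by
  obtain ⟨s', t, hP, ht, hs'⟩ := h
  obtain ⟨s'', t', hP', ht', hs''⟩ := h' s' (frame_of_exec hP) hs'
  exact ⟨s'', t + t', hP.seq hP', Nat.add_le_add ht ht', hs''⟩

theorem Runs.outputs {P : Program} {l o : List ℕ} {B : ℕ}
    (h : P.Runs (Mem.init l) B fun s => s.output = o) : ∃ t ≤ B, P.Outputs l o t := by
  obtain ⟨s, t, hE, ht, hs⟩ := h
  exact ⟨t, ht, s, hE, hs⟩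

/-- A loop whose counter `x` runs up to the constant bound `y`. -/
theorem Runs.forLT {P : Program} {x y N B : ℕ} {s : Mem} (I : ℕ → Mem → Prop)
    (hy : y ∉ P.writes) (hN : s.reg y = N) (hx : s.reg x = 0) (h0 : I 0 s)
    (hstep : ∀ j < N, ∀ s', P.Frame s s' → s'.reg x = j → I j s' →
      P.Runs s' B fun s'' => s''.reg x = j + 1 ∧ I (j + 1) s'') :
    (whileLT x y P).Runs s (N * (B + 1) + 1) (I N) := by
  suffices ∀ d j, j + d = N → ∀ s', P.Frame s s' → s'.reg x = j → I j s' →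
      (whileLT x y P).Runs s' (d * (B + 1) + 1) (I N) from
    this N 0 (zero_add N) s (.refl P s) hx h0
  intro d
  induction d with
  | zero =>
    rintro j rfl s' hframe hj hI
    have hexit : ¬ s'.reg x < s'.reg y := by rw [hframe.reg y hy, hN, hj]; exact lt_irrefl _
    exact ⟨s', 1, .whileFalse hexit, Nat.le_add_left _ _, hI⟩
  | succ d ih =>
    intro j hjN s' hframe hj hI
    have henter : s'.reg x < s'.reg y := by rw [hframe.reg y hy, hN, hj]; omega
    obtain ⟨s₁, t₁, hP, ht₁, hj₁, hI₁⟩ := hstep j (by omega) s' hframe hj hI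
    obtain ⟨s₂, t₂, hW, ht₂, hI₂⟩ :=
      ih (j + 1) (by omega) s₁ (hframe.trans (frame_of_exec hP)) hj₁ hI₁
    exact ⟨s₂, t₁ + t₂ + 1, .whileTrue henter hP hW, by rw [Nat.succ_mul]; omega, hI₂⟩

/-- Whether a program contains no loop. -/
def isLoopFree : Program → Bool
  | seq P Q | ifLT _ _ P Q => P.isLoopFree && Q.isLoopFree
  | whileLT _ _ _ => false
  | _ => true

/-- The effect of a program without loops; a loop is ignored. -/
def eval : Program → Mem → Mem
  | skip, s | whileLT _ _ _, s => s
  | const x c, s => s.setReg x c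
  | add x y z, s => s.setReg x (s.reg y + s.reg z)
  | sub x y z, s => s.setReg x (s.reg y - s.reg z)
  | load x a y, s => s.setReg x (s.arr a (s.reg y))
  | store a x y, s => s.setArr a (s.reg x) (s.reg y)
  | seq P Q, s => Q.eval (P.eval s)
  | ifLT x y P Q, s => if s.reg x < s.reg y then P.eval s else Q.eval s

/-- The number of instructions and tests of a program, a bound for the number of steps of a program
without loops. -/
def size : Program → ℕ
  | seq P Q => P.size + Q.size
  | ifLT _ _ P Q => P.size + Q.size + 1
  | _ => 1

theorem exec_eval {P : Program} (hP : P.isLoopFree) (s : Mem) :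
    ∃ t ≤ P.size, Exec P s (P.eval s) t := by
  induction P generalizing s with
  | skip => exact ⟨1, le_rfl, .skip s⟩
  | const x c => exact ⟨1, le_rfl, .const s x c⟩
  | add x y z => exact ⟨1, le_rfl, .add s x y z⟩
  | sub x y z => exact ⟨1, le_rfl, .sub s x y z⟩
  | load x a y => exact ⟨1, le_rfl, .load s x a y⟩
  | store a x y => exact ⟨1, le_rfl, .store s a x y⟩
  | seq P Q ihP ihQ =>
    rw [isLoopFree, Bool.and_eq_true] at hP
    obtain ⟨t, ht, h⟩ := ihP hP.1 s
    obtain ⟨u, hu, h'⟩ := ihQ hP.2 (P.eval s)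
    exact ⟨t + u, Nat.add_le_add ht hu, h.seq h'⟩
  | ifLT x y P Q ihP ihQ =>
    rw [isLoopFree, Bool.and_eq_true] at hP
    rw [eval, size]
    split_ifs with hlt
    · obtain ⟨t, ht, h⟩ := ihP hP.1 s
      exact ⟨t + 1, by omega, .ifTrue hlt h⟩
    · obtain ⟨t, ht, h⟩ := ihQ hP.2 s
      exact ⟨t + 1, by omega, .ifFalse hlt h⟩
  | whileLT => exact absurd hP Bool.false_ne_true

theorem frame_eval {P : Program} (hP : P.isLoopFree) (s : Mem) : P.Frame s (P.eval s) :=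
  let ⟨_, _, h⟩ := exec_eval hP s
  frame_of_exec h

theorem runs_of_isLoopFree {P : Program} (hP : P.isLoopFree) {s : Mem} {B : ℕ}
    {Q : Mem → Prop} (hB : P.size ≤ B) (hQ : Q (P.eval s)) : P.Runs s B Q := by
  obtain ⟨t, ht, h⟩ := exec_eval hP s
  exact ⟨_, t, h, ht.trans hB, hQ⟩

end Program

/-! ### The core program -/

-- Notation rather than definitions, so that `simp` and `decide` see the numerals.
local notation "rLength" => 1
local notation "rM" => 2
local notation "rN" => 3
local notation "rK" => 4
local notation "rZero" => 5
local notation "rOne" => 6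
local notation "rStride" => 7
local notation "rVotes" => 8
local notation "rState" => 9
local notation "rLayer" => 10
local notation "rVoter" => 11
local notation "rRank" => 12
local notation "rT" => 13
local notation "rCand" => 14
local notation "rSwitch" => 15
local notation "rSwitchVal" => 16
local notation "rBest" => 17
local notation "rPred" => 18
local notation "rVal" => 19
local notation "rTmp" => 20
local notation "rOffset" => 22
local notation "rMax" => 23
local notation "rAddr" => 24
local notation "aIn" => 0
local notation "aOut" => 1
local notation "aDissat" => 2
local notation "aCost" => 3
local notation "aVal" => 4
local notation "aPred" => 5
local notation "aCand" => 6
local notation "aBest" => 7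

section Tables

variable (ℓ : Aggregation) (m K : ℕ) (w : ℕ → ℕ → ℕ)

/-- The index of state `(t, c)` of voter `i` in the flat tables: states are numbered consecutively,
and those of layer `i * K + t` start at index `(i * K + t) * m`. -/
def flat (i t c : ℕ) : ℕ := (i * K + t) * m + c

/-- The flat table of values. -/
def valTable (p : ℕ) : ℕ := dpTable ℓ m w (p / m / K) (p / m % K) (p % m)

/-- The flat table of predecessors; it is meaningful from index `K * m` on. -/
def predTable (p : ℕ) : ℕ :=
  let q := dpPred m (dpTable ℓ m w (p / m / K - 1)) (p / m % K) (p % m)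
  flat m K (p / m / K - 1) q.1 q.2

/-- The flat table of the best states of each layer. -/
def bestTable (q : ℕ) : ℕ := q * m + argminBelow (dpTable ℓ m w (q / K) (q % K)) m

variable {m K} (i : ℕ) {t c : ℕ}

theorem flat_div_mod (t : ℕ) (hc : c < m) :
    flat m K i t c / m = i * K + t ∧ flat m K i t c % m = c :=
  (Nat.div_mod_unique (Nat.zero_lt_of_lt hc)).2
    ⟨by rw [flat, Nat.mul_comm m, Nat.add_comm], hc⟩

theorem layer_div_mod (ht : t < K) : (i * K + t) / K = i ∧ (i * K + t) % K = t :=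
  (Nat.div_mod_unique (Nat.zero_lt_of_lt ht)).2 ⟨by rw [Nat.mul_comm K, Nat.add_comm], ht⟩

theorem valTable_flat (ht : t < K) (hc : c < m) :
    valTable ℓ m K w (flat m K i t c) = dpTable ℓ m w i t c := by
  rw [valTable, (flat_div_mod i t hc).1, (flat_div_mod i t hc).2, (layer_div_mod i ht).1,
    (layer_div_mod i ht).2]

theorem predTable_flat (ht : t < K) (hc : c < m) :
    predTable ℓ m K w (flat m K (i + 1) t c) =
      flat m K i (dpPred m (dpTable ℓ m w i) t c).1 (dpPred m (dpTable ℓ m w i) t c).2 := by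
  rw [predTable, (flat_div_mod _ t hc).1, (flat_div_mod _ t hc).2, (layer_div_mod _ ht).1,
    (layer_div_mod _ ht).2]
  rfl

theorem bestTable_layer (ht : t < K) :
    bestTable ℓ m K w (i * K + t) = flat m K i t (argminBelow (dpTable ℓ m w i t) m) := by
  rw [bestTable, (layer_div_mod i ht).1, (layer_div_mod i ht).2, flat]

theorem valTable_bestTable (ht : t < K) (hm : 0 < m) :
    valTable ℓ m K w (bestTable ℓ m K w (i * K + t)) =
      dpTable ℓ m w i t (argminBelow (dpTable ℓ m w i t) m) := by
  rw [bestTable_layer ℓ w i ht, valTable_flat ℓ w i ht (argminBelow_lt _ hm)]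

theorem predTable_flat_eq_ite (ht : t < K) (hc : c < m) :
    predTable ℓ m K w (flat m K (i + 1) t c) =
      if 0 < t ∧ valTable ℓ m K w (bestTable ℓ m K w (i * K + (t - 1))) <
          valTable ℓ m K w (flat m K i t c) then
        bestTable ℓ m K w (i * K + (t - 1)) else flat m K i t c := by
  have ht' : t - 1 < K := (Nat.sub_le _ _).trans_lt ht
  rw [predTable_flat ℓ w i ht hc, dpPred, valTable_flat ℓ w i ht hc,
    valTable_bestTable ℓ w i ht' (Nat.zero_lt_of_lt hc), bestTable_layer ℓ w i ht']
  split_ifs <;> rfl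

theorem valTable_flat_succ (ht : t < K) (hc : c < m) :
    valTable ℓ m K w (flat m K (i + 1) t c) =
      ℓ.op (valTable ℓ m K w (predTable ℓ m K w (flat m K (i + 1) t c))) (w i c) := by
  rw [predTable_flat ℓ w i ht hc, valTable_flat ℓ w _ ht hc,
    valTable_flat ℓ w i ((dpPred_fst_le _ _).trans_lt ht) (dpPred_snd_lt _ _ hc), dpTable]

theorem valTable_of_lt {p : ℕ} (hp : p < K * m) : valTable ℓ m K w p = 0 := by
  rw [valTable, Nat.div_div_eq_div_mul, Nat.mul_comm, Nat.div_eq_of_lt hp, dpTable]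

theorem argminBelow_const (b c : ℕ) : argminBelow (fun _ => b) c = 0 := by
  induction c with
  | zero => rfl
  | succ c ih => rw [argminBelow, if_neg (lt_irrefl _), ih]

theorem bestTable_of_lt {q : ℕ} (hq : q < K) : bestTable ℓ m K w q = q * m := by
  have hzero : dpTable ℓ m w 0 (q % K) = fun _ => 0 := rfl
  rw [bestTable, Nat.div_eq_of_lt hq, hzero, argminBelow_const, add_zero]

theorem flat_succ_sub (t c : ℕ) : flat m K (i + 1) t c - K * m = flat m K i t c := by
  rw [flat, flat, Nat.succ_mul, Nat.add_right_comm, Nat.add_mul _ K, Nat.add_right_comm,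
    Nat.add_sub_cancel]

theorem flat_lt_of_lt {i' t' : ℕ} (c' : ℕ) (h : i * K + t < i' * K + t') (hc : c < m) :
    flat m K i t c < flat m K i' t' c' :=
  calc (i * K + t) * m + c < (i * K + t) * m + m := by gcongr
    _ = (i * K + t + 1) * m := (Nat.succ_mul _ _).symm
    _ ≤ (i' * K + t') * m := Nat.mul_le_mul_right m h
    _ ≤ (i' * K + t') * m + c' := Nat.le_add_right _ _

theorem eqOn_update_Ico {a f : ℕ → ℕ} {lo p : ℕ} (h : Set.EqOn a f (Set.Ico lo p)) :
    Set.EqOn (Function.update a p (f p)) f (Set.Ico lo (p + 1)) := by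
  intro x hx
  rcases eq_or_ne x p with rfl | hne
  · exact Function.update_self _ _ _
  · rw [Function.update_of_ne hne]
    exact h ⟨hx.1, (Nat.le_of_lt_succ hx.2).lt_of_ne hne⟩

end Tables

namespace Program

/-- `reg x := op (reg y) (reg z)`. -/
def combine : Aggregation → ℕ → ℕ → ℕ → Program
  | .l1, x, y, z => .add x y z
  | .linf, x, y, z => .ifLT y z (.add x z rZero) (.add x y rZero)

/-- Choose the best predecessor of a state. -/
def choosePred : Program :=
  .seq (.sub rPred rState rStride) <|
  .seq (.load rVal aVal rPred) <|
  .ifLT rZero rT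
    (.ifLT rSwitchVal rVal (.seq (.add rPred rSwitch rZero) (.add rVal rSwitchVal rZero)) .skip)
    .skip

/-- Add the cost of the current voter to the value of the predecessor. -/
def addCost (ℓ : Aggregation) : Program :=
  .seq (.load rTmp aCost rCand) (.combine ℓ rVal rVal rTmp)

/-- Fill in the table entries of a state and move on to the next one. -/
def recordState : Program :=
  .seq (.store aVal rState rVal) <|
  .seq (.store aPred rState rPred) <|
  .seq (.store aCand rState rCand) <|
  .seq (.add rState rState rOne) (.add rCand rCand rOne)

/-- Compare the state just recorded with the best one of its layer so far. -/
def updateBest : Program :=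
  .seq (.load rTmp aVal rBest) <|
  .ifLT rVal rTmp (.sub rBest rState rOne) .skip

/-- Process one state. -/
def processState (ℓ : Aggregation) : Program :=
  .seq .choosePred (.seq (.addCost ℓ) (.seq .recordState .updateBest))

/-- Find the best state with one change less, and prepare for the states of a layer. -/
def startLayer : Program :=
  .seq (.sub rSwitch rLayer rK) <|
  .seq (.sub rSwitch rSwitch rOne) <|
  .seq (.load rSwitch aBest rSwitch) <|
  .seq (.load rSwitchVal aVal rSwitch) <|
  .seq (.const rCand 0) (.add rBest rState rZero)

/-- Record the best state of a layer and move on to the next layer. -/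
def finishLayer : Program :=
  .seq (.store aBest rLayer rBest) <|
  .seq (.add rLayer rLayer rOne) (.add rT rT rOne)

/-- Process all states of one layer. -/
def processLayer (ℓ : Aggregation) : Program :=
  .seq .startLayer (.seq (.whileLT rCand rM (.processState ℓ)) .finishLayer)

/-- Tabulate the costs of one voter. -/
def readVote : Program :=
  .seq (.const rRank 0) <|
  .whileLT rRank rM <|
    .seq (.load rTmp aDissat rRank) <|
    .seq (.load rCand aIn rVotes) <|
    .seq (.store aCost rCand rTmp) <|
    .seq (.add rVotes rVotes rOne) (.add rRank rRank rOne)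

/-- Process all layers of one voter. -/
def processVoter (ℓ : Aggregation) : Program :=
  .seq .readVote <|
  .seq (.const rT 0) <|
  .seq (.whileLT rT rK (.processLayer ℓ)) (.add rVoter rVoter rOne)

/-- Set up the constants; more than `n` values are never needed. -/
def initRegs : Program :=
  .seq (.const rZero 0) <|
  .seq (.const rOne 1) <|
  .seq (.ifLT rN rK (.add rK rN rZero) .skip) <|
  .seq (.const rState 0) <|
  .seq (.const rLayer 0) (.const rVoter 0)

/-- Set up the registers and the rows of the tables that belong to no voter. -/
def initTables : Program :=
  .seq .initRegs <|
  .seq (.whileLT rLayer rK <|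
    .seq (.store aBest rLayer rState) <|
    .seq (.add rState rState rM) (.add rLayer rLayer rOne)) <|
  .add rStride rState rZero

/-- Write down the candidate of the current state and go to its predecessor. -/
def traceStep : Program :=
  .seq (.sub rVoter rVoter rOne) <|
  .seq (.load rCand aCand rState) <|
  .seq (.store aOut rVoter rCand) <|
  .seq (.load rState aPred rState) (.add rRank rRank rOne)

/-- Read off the assignment. -/
def traceBack : Program :=
  .seq (.seq (.sub rLayer rLayer rOne) (.seq (.load rState aBest rLayer) (.const rRank 0))) <|
  .seq (.whileLT rRank rN .traceStep) (.add rLength rN rZero)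

/-- The dynamic program, given `m`, `n`, `k`, the dissatisfaction function, and the votes. -/
def core (ℓ : Aggregation) : Program :=
  .seq .initTables (.seq (.whileLT rVoter rN (.processVoter ℓ)) .traceBack)

end Program

section Correctness

variable (ℓ : Aggregation) (m n K : ℕ) (A X : ℕ → ℕ) (w : ℕ → ℕ → ℕ)

/-- The part of the memory that does not change during the main loop. -/
structure Env (s : Mem) : Prop where
  reg_m : s.reg rM = m
  reg_n : s.reg rN = n
  reg_K : s.reg rK = K
  reg_zero : s.reg rZero = 0
  reg_one : s.reg rOne = 1
  reg_stride : s.reg rStride = K * m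
  arr_dissat : s.arr aDissat = A
  arr_input : s.arr aIn = X

/-- The tables are filled in for the first `q` layers and the first `c` states of layer `q`. -/
structure Tables (q c : ℕ) (s : Mem) : Prop where
  reg_state : s.reg rState = q * m + c
  reg_layer : s.reg rLayer = q
  val : Set.EqOn (s.arr aVal) (valTable ℓ m K w) (Set.Ico 0 (q * m + c))
  pred : Set.EqOn (s.arr aPred) (predTable ℓ m K w) (Set.Ico (K * m) (q * m + c))
  cand : Set.EqOn (s.arr aCand) (· % m) (Set.Ico (K * m) (q * m + c))
  best : Set.EqOn (s.arr aBest) (bestTable ℓ m K w) (Set.Ico 0 q)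

/-- The part of the memory that does not change while layer `t` of voter `i` is processed. -/
structure LayerEnv (i t : ℕ) (s : Mem) : Prop extends Env m n K A X s where
  reg_t : s.reg rT = t
  cost : Set.EqOn (s.arr aCost) (w i) (Set.Iio m)
  switch : 0 < t → s.reg rSwitch = bestTable ℓ m K w (i * K + (t - 1))
  switchVal : 0 < t →
    s.reg rSwitchVal = valTable ℓ m K w (bestTable ℓ m K w (i * K + (t - 1)))

variable {ℓ m n K A X w} {i t q c : ℕ} {P : Program} {s s' : Mem}

theorem Env.of_frame (h : Env m n K A X s) (hf : P.Frame s s')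
    (hw : Disjoint P.writes {rM, rN, rK, rZero, rOne, rStride})
    (hs : Disjoint P.stores {aIn, aDissat}) : Env m n K A X s' := by
  have hreg : ∀ x ∈ ({rM, rN, rK, rZero, rOne, rStride} : Finset ℕ), s'.reg x = s.reg x :=
    fun x hx => hf.reg x (Finset.disjoint_right.1 hw hx)
  have harr : ∀ a ∈ ({aIn, aDissat} : Finset ℕ), s'.arr a = s.arr a :=
    fun a ha => hf.arr a (Finset.disjoint_right.1 hs ha)
  constructor <;> simp only [hreg, harr, Finset.mem_insert, Finset.mem_singleton, true_or, or_true,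
    h.reg_m, h.reg_n, h.reg_K, h.reg_zero, h.reg_one, h.reg_stride, h.arr_dissat, h.arr_input]

theorem Tables.of_frame (h : Tables ℓ m K w q c s) (hf : P.Frame s s')
    (hw : Disjoint P.writes {rState, rLayer})
    (hs : Disjoint P.stores {aVal, aPred, aCand, aBest}) : Tables ℓ m K w q c s' := by
  have hreg : ∀ x ∈ ({rState, rLayer} : Finset ℕ), s'.reg x = s.reg x :=
    fun x hx => hf.reg x (Finset.disjoint_right.1 hw hx)
  have harr : ∀ a ∈ ({aVal, aPred, aCand, aBest} : Finset ℕ), s'.arr a = s.arr a :=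
    fun a ha => hf.arr a (Finset.disjoint_right.1 hs ha)
  constructor <;> simp only [hreg, harr, Finset.mem_insert, Finset.mem_singleton, true_or, or_true,
    h.reg_state, h.reg_layer, h.val, h.pred, h.cand, h.best]

theorem LayerEnv.of_frame (h : LayerEnv ℓ m n K A X w i t s) (hf : P.Frame s s')
    (hw : Disjoint P.writes
      {rM, rN, rK, rZero, rOne, rStride, rT, rSwitch, rSwitchVal})
    (hs : Disjoint P.stores {aIn, aDissat, aCost}) : LayerEnv ℓ m n K A X w i t s' where
  toEnv := h.toEnv.of_frame hf (hw.mono_right (by decide)) (hs.mono_right (by decide))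
  reg_t := (hf.reg rT (Finset.disjoint_right.1 hw (by decide))).trans h.reg_t
  cost := by
    rw [hf.arr aCost (Finset.disjoint_right.1 hs (by decide))]
    exact h.cost
  switch := by
    rw [hf.reg rSwitch (Finset.disjoint_right.1 hw (by decide))]
    exact h.switch
  switchVal := by
    rw [hf.reg rSwitchVal (Finset.disjoint_right.1 hw (by decide))]
    exact h.switchVal

end Correctness

section Correctness

variable {ℓ : Aggregation} {m n K : ℕ} {A X : ℕ → ℕ} {w : ℕ → ℕ → ℕ}
  {i t q c : ℕ} {s : Mem}

open Program

theorem LayerEnv.runs_choosePred (h : LayerEnv ℓ m n K A X w i t s)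
    (hT : Tables ℓ m K w ((i + 1) * K + t) c s) (ht : t < K) (hc : c < m) :
    choosePred.Runs s 8 fun s' =>
      s'.reg rPred = predTable ℓ m K w (flat m K (i + 1) t c) ∧
        s'.reg rVal = valTable ℓ m K w (predTable ℓ m K w (flat m K (i + 1) t c)) := by
  have hpred : s.reg rState - s.reg rStride = flat m K i t c := by
    rw [hT.reg_state, h.reg_stride]
    exact flat_succ_sub i t c
  have hval : s.arr aVal (flat m K i t c) = valTable ℓ m K w (flat m K i t c) :=
    hT.val ⟨Nat.zero_le _, flat_lt_of_lt i c (by rw [Nat.succ_mul]; omega) hc⟩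
  refine runs_of_isLoopFree rfl le_rfl ?_
  rw [predTable_flat_eq_ite ℓ w i ht hc]
  rcases Nat.eq_zero_or_pos t with rfl | hpos
  · simp [choosePred, eval, hpred, hval, h.reg_zero, h.reg_t]
  · have hswitch := h.switch hpos
    have hswitchVal := h.switchVal hpos
    simp only [choosePred, eval, Mem.reg_setReg, Mem.arr_setReg, Nat.reduceEqDiff,
      if_true, if_false, hpred, hval, h.reg_zero, h.reg_t, hpos, hswitchVal, true_and]
    split_ifs <;> simp [hswitch]

theorem eval_combine (h : s.reg rZero = 0) (x y z : ℕ) :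
    (combine ℓ x y z).eval s = s.setReg x (ℓ.op (s.reg y) (s.reg z)) := by
  cases ℓ with
  | l1 => rfl
  | linf =>
    simp only [combine, eval, h, add_zero, Aggregation.op]
    split_ifs with hlt
    · rw [max_eq_right hlt.le]
    · rw [max_eq_left (not_lt.1 hlt)]

theorem LayerEnv.runs_addCost (h : LayerEnv ℓ m n K A X w i t s) (ht : t < K) (hc : c < m)
    (hcand : s.reg rCand = c)
    (hval : s.reg rVal = valTable ℓ m K w (predTable ℓ m K w (flat m K (i + 1) t c))) :
    (addCost ℓ).Runs s 4 fun s' => s'.reg rVal = valTable ℓ m K w (flat m K (i + 1) t c) := by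
  refine runs_of_isLoopFree (by cases ℓ <;> rfl) (by cases ℓ <;> decide) ?_
  have hcost : s.arr aCost (s.reg rCand) = w i c := by rw [hcand, h.cost hc]
  rw [valTable_flat_succ ℓ w i ht hc, addCost, eval, eval_combine (by simp [eval, h.reg_zero])]
  simp [eval, hcost, hval]

theorem Tables.runs_recordState (hT : Tables ℓ m K w q c s) (hc : c < m) (hone : s.reg rOne = 1)
    (hcand : s.reg rCand = c) (hpred : s.reg rPred = predTable ℓ m K w (q * m + c))
    (hval : s.reg rVal = valTable ℓ m K w (q * m + c)) :
    recordState.Runs s 5 fun s' => s'.reg rCand = c + 1 ∧ Tables ℓ m K w q (c + 1) s' := by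
  refine runs_of_isLoopFree rfl le_rfl ⟨by simp [recordState, eval, hone, hcand], ?_⟩
  have hmod : s.reg rCand = (fun p => p % m) (q * m + c) := by
    rw [hcand]
    exact (Nat.mul_add_mod_of_lt hc).symm
  constructor
  · simp [recordState, eval, hT.reg_state, hone, add_assoc]
  · simp [recordState, eval, hT.reg_layer]
  · simpa [recordState, eval, hT.reg_state, hval, ← add_assoc] using eqOn_update_Ico hT.val
  · simpa [recordState, eval, hT.reg_state, hpred, ← add_assoc] using eqOn_update_Ico hT.pred
  · simpa [recordState, eval, hT.reg_state, hmod, ← add_assoc] using eqOn_update_Ico hT.cand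
  · simpa [recordState, eval] using hT.best

theorem Tables.runs_updateBest (hT : Tables ℓ m K w ((i + 1) * K + t) (c + 1) s) (ht : t < K)
    (hc : c < m) (hone : s.reg rOne = 1)
    (hval : s.reg rVal = valTable ℓ m K w (flat m K (i + 1) t c))
    (hbest : s.reg rBest = flat m K (i + 1) t (argminBelow (dpTable ℓ m w (i + 1) t) c)) :
    updateBest.Runs s 4 fun s' =>
      s'.reg rBest = flat m K (i + 1) t (argminBelow (dpTable ℓ m w (i + 1) t) (c + 1)) := by
  refine runs_of_isLoopFree rfl le_rfl ?_
  have hle : argminBelow (dpTable ℓ m w (i + 1) t) c ≤ c := argminBelow_le _ _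
  have hload : s.arr aVal (s.reg rBest) =
      dpTable ℓ m w (i + 1) t (argminBelow (dpTable ℓ m w (i + 1) t) c) := by
    rw [hbest, ← valTable_flat ℓ w _ ht (hle.trans_lt hc)]
    exact hT.val ⟨Nat.zero_le _, Nat.add_lt_add_left (Nat.lt_succ_of_le hle) _⟩
  rw [valTable_flat ℓ w _ ht hc] at hval
  have hstate : s.reg rState - s.reg rOne = flat m K (i + 1) t c := by
    rw [hT.reg_state, hone]
    rfl
  rw [argminBelow]
  simp only [updateBest, eval, Mem.reg_setReg, Nat.reduceEqDiff, if_true, if_false, hload, hval,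
    hstate]
  split_ifs <;> simp [hbest]

theorem LayerEnv.runs_processState (h : LayerEnv ℓ m n K A X w i t s)
    (hT : Tables ℓ m K w ((i + 1) * K + t) c s) (ht : t < K) (hc : c < m)
    (hcand : s.reg rCand = c)
    (hbest : s.reg rBest = flat m K (i + 1) t (argminBelow (dpTable ℓ m w (i + 1) t) c)) :
    (processState ℓ).Runs s 21 fun s' =>
      s'.reg rCand = c + 1 ∧ Tables ℓ m K w ((i + 1) * K + t) (c + 1) s' ∧
        s'.reg rBest = flat m K (i + 1) t (argminBelow (dpTable ℓ m w (i + 1) t) (c + 1)) := by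
  refine (h.runs_choosePred hT ht hc).seq (B' := 13) fun s₁ f₁ ⟨hpred, hpredVal⟩ => ?_
  have h₁ := h.of_frame f₁ (by decide) (by decide)
  have hT₁ := hT.of_frame f₁ (by decide) (by decide)
  have hcand₁ := (f₁.reg rCand (by decide)).trans hcand
  have hbest₁ := (f₁.reg rBest (by decide)).trans hbest
  refine (h₁.runs_addCost ht hc hcand₁ hpredVal).seq (B' := 9) fun s₂ f₂ hval => ?_
  have h₂ := h₁.of_frame f₂ (by cases ℓ <;> decide) (by cases ℓ <;> decide)
  have hT₂ := hT₁.of_frame f₂ (by cases ℓ <;> decide) (by cases ℓ <;> decide)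
  have hcand₂ := (f₂.reg rCand (by cases ℓ <;> decide)).trans hcand₁
  have hpred₂ := (f₂.reg rPred (by cases ℓ <;> decide)).trans hpred
  have hbest₂ := (f₂.reg rBest (by cases ℓ <;> decide)).trans hbest₁
  have hrun := hT₂.runs_recordState hc h₂.reg_one hcand₂ hpred₂ hval
  refine hrun.seq (B' := 4) fun s₃ f₃ ⟨hcand₃, hT₃⟩ => ?_
  have hone₃ := (f₃.reg rOne (by decide)).trans h₂.reg_one
  have hval₃ := (f₃.reg rVal (by decide)).trans hval
  have hbest₃ := (f₃.reg rBest (by decide)).trans hbest₂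
  exact (hT₃.runs_updateBest ht hc hone₃ hval₃ hbest₃).mono le_rfl fun s₄ f₄ hbest₄ =>
    ⟨(f₄.reg rCand (by decide)).trans hcand₃, hT₃.of_frame f₄ (by decide) (by decide), hbest₄⟩

end Correctness

section Correctness

variable {ℓ : Aggregation} {m n K : ℕ} {A X : ℕ → ℕ} {w : ℕ → ℕ → ℕ}
  {base i t q c : ℕ} {s : Mem}

open Program

theorem Env.runs_startLayer (h : Env m n K A X s) (hT : Tables ℓ m K w ((i + 1) * K + t) 0 s)
    (hm : 0 < m) (ht : t < K) (hrT : s.reg rT = t)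
    (hcost : Set.EqOn (s.arr aCost) (w i) (Set.Iio m)) :
    startLayer.Runs s 6 fun s' => LayerEnv ℓ m n K A X w i t s' ∧
      s'.reg rCand = 0 ∧ s'.reg rBest = flat m K (i + 1) t 0 := by
  have hlayer : (i + 1) * K + t = i * K + t + K := by ring
  have hstate : s.reg rState = flat m K (i + 1) t 0 := hT.reg_state
  have hbest : 0 < t →
      s.arr aBest (s.reg rLayer - K - 1) = bestTable ℓ m K w (i * K + (t - 1)) := fun hpos => by
    rw [hT.reg_layer, hlayer, Nat.add_sub_cancel, Nat.add_sub_assoc hpos]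
    exact hT.best ⟨Nat.zero_le _, by omega⟩
  have hval : 0 < t → s.arr aVal (bestTable ℓ m K w (i * K + (t - 1))) =
      valTable ℓ m K w (bestTable ℓ m K w (i * K + (t - 1))) := fun hpos => by
    refine hT.val ⟨Nat.zero_le _, ?_⟩
    rw [bestTable_layer ℓ w i (by omega)]
    exact flat_lt_of_lt i 0 (by omega) (argminBelow_lt _ hm)
  refine runs_of_isLoopFree rfl le_rfl ⟨⟨?_, ?_, ?_, ?_, ?_⟩, ?_, ?_⟩
  · exact h.of_frame (frame_eval rfl s) (by decide) (by decide)
  · simp [startLayer, eval, hrT]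
  · simpa [startLayer, eval] using hcost
  · simpa [startLayer, eval, h.reg_K, h.reg_one] using hbest
  · intro hpos
    simp [startLayer, eval, h.reg_K, h.reg_one, hbest hpos, hval hpos]
  · simp [startLayer, eval]
  · simp [startLayer, eval, h.reg_zero, hstate]

theorem Tables.runs_finishLayer (hT : Tables ℓ m K w q m s) (hone : s.reg rOne = 1)
    (hrT : s.reg rT = t) (hbest : s.reg rBest = bestTable ℓ m K w q) :
    finishLayer.Runs s 3 fun s' => s'.reg rT = t + 1 ∧ Tables ℓ m K w (q + 1) 0 s' := by
  refine runs_of_isLoopFree rfl le_rfl ⟨by simp [finishLayer, eval, hone, hrT], ?_⟩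
  have hend : (q + 1) * m + 0 = q * m + m := Nat.succ_mul q m
  constructor <;> try rw [hend]
  · simp [finishLayer, eval, hT.reg_state]
  · simp [finishLayer, eval, hT.reg_layer, hone]
  · simpa [finishLayer, eval] using hT.val
  · simpa [finishLayer, eval] using hT.pred
  · simpa [finishLayer, eval] using hT.cand
  · simpa [finishLayer, eval, hT.reg_layer, hbest] using eqOn_update_Ico hT.best

theorem Env.runs_processLayer (h : Env m n K A X s)
    (hT : Tables ℓ m K w ((i + 1) * K + t) 0 s) (hm : 0 < m) (ht : t < K) (hrT : s.reg rT = t)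
    (hcost : Set.EqOn (s.arr aCost) (w i) (Set.Iio m)) :
    (processLayer ℓ).Runs s (32 * m) fun s' =>
      s'.reg rT = t + 1 ∧ Tables ℓ m K w ((i + 1) * K + (t + 1)) 0 s' := by
  suffices (processLayer ℓ).Runs s (6 + (m * (21 + 1) + 1 + 3)) _ from
    this.mono (by omega) fun _ _ => id
  refine (h.runs_startLayer hT hm ht hrT hcost).seq fun s₁ f₁ ⟨h₁, hcand₁, hbest₁⟩ => ?_
  have hT₁ := hT.of_frame f₁ (by decide) (by decide)
  refine (Runs.forLT
    (fun c s' => Tables ℓ m K w ((i + 1) * K + t) c s' ∧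
      s'.reg rBest = flat m K (i + 1) t (argminBelow (dpTable ℓ m w (i + 1) t) c))
    (by cases ℓ <;> decide) h₁.reg_m hcand₁ ⟨hT₁, hbest₁⟩
    fun c hc s' f hcand ⟨hT', hbest⟩ =>
      (h₁.of_frame f (by cases ℓ <;> decide) (by cases ℓ <;> decide)).runs_processState
        hT' ht hc hcand hbest).seq fun s₂ f₂ ⟨hT₂, hbest₂⟩ => ?_
  have h₂ := h₁.of_frame f₂ (by cases ℓ <;> decide) (by cases ℓ <;> decide)
  exact hT₂.runs_finishLayer h₂.reg_one h₂.reg_t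
    (hbest₂.trans (bestTable_layer ℓ w (i + 1) ht).symm)

variable (m n A X w base) in
/-- The ballots of the voters are stored one after another in `X`, starting at index `base`, and
`w i c` is the cost of candidate `c` for voter `i`. -/
structure Ballots : Prop where
  cost : ∀ i < n, ∀ r < m, A r = w i (X (base + i * m + r))
  surj : ∀ i < n, ∀ c < m, ∃ r < m, X (base + i * m + r) = c

theorem Env.runs_readVote (h : Env m n K A X s) (hX : Ballots m n A X w base) (hi : i < n)
    (hvotes : s.reg rVotes = base + i * m) :
    readVote.Runs s (6 * m + 2) fun s' =>
      s'.reg rVotes = base + (i + 1) * m ∧ Set.EqOn (s'.arr aCost) (w i) (Set.Iio m) := by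
  suffices readVote.Runs s (1 + (m * (5 + 1) + 1)) _ from this.mono (by omega) fun _ _ => id
  refine (runs_of_isLoopFree (P := .const rRank 0) rfl le_rfl
    (Q := fun s' => s'.reg rRank = 0) rfl).seq fun s₁ f₁ hrank => ?_
  have h₁ := h.of_frame f₁ (by decide) (by decide)
  refine (Runs.forLT (fun r s' => s'.reg rVotes = base + i * m + r ∧
    ∀ r' < r, s'.arr aCost (X (base + i * m + r')) = w i (X (base + i * m + r')))
    (by decide) h₁.reg_m hrank ⟨(f₁.reg _ (by decide)).trans hvotes, by simp⟩ ?_).mono le_rfl ?_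
  · rintro r hr s' f hrank' ⟨hvotes', hcost⟩
    have h' := h₁.of_frame f (by decide) (by decide)
    refine runs_of_isLoopFree rfl le_rfl ⟨?_, ?_, ?_⟩
    · simp [eval, hrank', h'.reg_one]
    · simp [eval, hvotes', h'.reg_one, add_assoc]
    · have hupdate : ∀ r' < r + 1, Function.update (s'.arr aCost) (X (base + i * m + r))
          (w i (X (base + i * m + r))) (X (base + i * m + r')) = w i (X (base + i * m + r')) := by
        grind [Function.update_apply]
      simpa [eval, h'.arr_dissat, h'.arr_input, hvotes', hrank', hX.cost i hi r hr] using hupdate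
  · rintro s' - ⟨hvotes', hcost⟩
    refine ⟨by rw [hvotes']; ring, fun c hc => ?_⟩
    obtain ⟨r, hr, rfl⟩ := hX.surj i hi c hc
    exact hcost r hr

theorem Env.runs_processVoter (h : Env m n K A X s) (hX : Ballots m n A X w base) (hm : 0 < m)
    (hi : i < n) (hK : 0 < K) (hvoter : s.reg rVoter = i) (hT : Tables ℓ m K w ((i + 1) * K) 0 s)
    (hvotes : s.reg rVotes = base + i * m) :
    (processVoter ℓ).Runs s (44 * (m * K)) fun s' => s'.reg rVoter = i + 1 ∧
      Tables ℓ m K w ((i + 1 + 1) * K) 0 s' ∧ s'.reg rVotes = base + (i + 1) * m := by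
  have hbound : 6 * m + 2 + (1 + (K * (32 * m + 1) + 1 + 1)) ≤ 44 * (m * K) := by
    linarith [Nat.le_mul_of_pos_right m hK, Nat.le_mul_of_pos_left K hm, Nat.mul_pos hm hK]
  suffices (processVoter ℓ).Runs s (6 * m + 2 + (1 + (K * (32 * m + 1) + 1 + 1))) _ from
    this.mono hbound fun _ _ => id
  refine (h.runs_readVote hX hi hvotes).seq fun s₁ f₁ ⟨hvotes₁, hcost₁⟩ => ?_
  refine (runs_of_isLoopFree (P := .const rT 0) rfl le_rfl
    (Q := fun s' => s'.reg rT = 0) rfl).seq fun s₂ f₂ hrT₂ => ?_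
  have h₂ := (h.of_frame f₁ (by decide) (by decide)).of_frame f₂ (by decide) (by decide)
  have hT₂ := (hT.of_frame f₁ (by decide) (by decide)).of_frame f₂ (by decide) (by decide)
  have hcost₂ := hcost₁
  rw [← f₂.arr aCost (by decide)] at hcost₂
  refine (Runs.forLT (fun t s' => Tables ℓ m K w ((i + 1) * K + t) 0 s')
    (by cases ℓ <;> decide) h₂.reg_K hrT₂ hT₂ fun t ht s' f hrT hT' => ?_).seq fun s₃ f₃ hT₃ => ?_
  · rw [← f.arr aCost (by cases ℓ <;> decide)] at hcost₂
    exact (h₂.of_frame f (by cases ℓ <;> decide) (by cases ℓ <;> decide)).runs_processLayer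
      hT' hm ht hrT hcost₂
  have hvoter₃ : s₃.reg rVoter = i := by
    rw [f₃.reg _ (by cases ℓ <;> decide), f₂.reg _ (by decide), f₁.reg _ (by decide), hvoter]
  have hone₃ : s₃.reg rOne = 1 := by rw [f₃.reg _ (by cases ℓ <;> decide), h₂.reg_one]
  have hvotes₃ : s₃.reg rVotes = base + (i + 1) * m := by
    rw [f₃.reg _ (by cases ℓ <;> decide), f₂.reg _ (by decide), hvotes₁]
  rw [← Nat.succ_mul] at hT₃
  refine runs_of_isLoopFree rfl le_rfl ⟨by simp [eval, hvoter₃, hone₃], ?_,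
    by simp [eval, hvotes₃]⟩
  exact hT₃.of_frame (frame_eval rfl s₃) (by decide) (by decide)

variable (m n A X base) in
/-- The memory is prepared for the core program, with `k` as the number of candidates allowed. -/
structure Ready (k : ℕ) (s : Mem) : Prop where
  reg_m : s.reg rM = m
  reg_n : s.reg rN = n
  reg_k : s.reg rK = k
  reg_votes : s.reg rVotes = base
  arr_dissat : s.arr aDissat = A
  arr_input : s.arr aIn = X
  arr_val : ∀ p, s.arr aVal p = 0

theorem Ready.runs_initRegs {k : ℕ} (h : Ready m n A X base k s) :
    initRegs.Runs s 8 fun s' => s'.reg rK = min k n ∧ s'.reg rZero = 0 ∧ s'.reg rOne = 1 ∧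
      s'.reg rState = 0 ∧ s'.reg rLayer = 0 ∧ s'.reg rVoter = 0 := by
  refine runs_of_isLoopFree rfl le_rfl ?_
  simp only [initRegs, eval, Mem.reg_setReg, h.reg_n, h.reg_k, Nat.reduceEqDiff, if_false]
  split_ifs with hlt
  · simp [min_eq_right hlt.le]
  · simp [h.reg_k, min_eq_left (not_lt.1 hlt)]

theorem Ready.runs_initTables {k : ℕ} (h : Ready m n A X base k s) :
    initTables.Runs s (4 * min k n + 10) fun s' =>
      Env m n (min k n) A X s' ∧ Tables ℓ m (min k n) w (min k n) 0 s' ∧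
        s'.reg rVoter = 0 ∧ s'.reg rVotes = base := by
  suffices initTables.Runs s (8 + (min k n * (3 + 1) + 1 + 1)) _ from
    this.mono (by omega) fun _ _ => id
  refine h.runs_initRegs.seq fun s₁ f₁ ⟨hK, hzero, hone, hstate, hlayer, hvoter⟩ => ?_
  have hm₁ := (f₁.reg rM (by decide)).trans h.reg_m
  refine (Runs.forLT (fun q s' => s'.reg rLayer = q ∧ s'.reg rState = q * m ∧
    Set.EqOn (s'.arr aBest) (fun q => q * m) (Set.Ico 0 q)) (by decide) hK hlayer
    ⟨hlayer, by simp [hstate], by simp [Set.EqOn]⟩ fun q _ s' f hq' ⟨_, hstate', hbest⟩ =>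
      ?_).seq fun s₂ f₂ ⟨hlayer₂, hstate₂, hbest₂⟩ => ?_
  · have hone' := (f.reg rOne (by decide)).trans hone
    have hm' := (f.reg rM (by decide)).trans hm₁
    refine runs_of_isLoopFree rfl le_rfl ⟨?_, ?_, ?_, ?_⟩
    · simp [eval, hq', hone']
    · simp [eval, hq', hone']
    · simp [eval, hstate', hm', Nat.succ_mul]
    · simpa [eval, hq', hstate'] using eqOn_update_Ico hbest
  have hframe : initTables.Frame s s₂ :=
    (f₁.weaken (by decide) (by decide)).trans (f₂.weaken (by decide) (by decide))
  have hzero₂ := (f₂.reg rZero (by decide)).trans hzero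
  refine runs_of_isLoopFree rfl le_rfl ⟨?_, ?_, ?_, ?_⟩
  · constructor <;> simp [eval, hframe.reg rM (by decide), h.reg_m, hframe.reg rN (by decide),
      h.reg_n, f₂.reg rK (by decide), hK, hzero₂, f₂.reg rOne (by decide), hone, hstate₂,
      hframe.arr aDissat (by decide), h.arr_dissat, hframe.arr aIn (by decide), h.arr_input]
  · constructor
    · simp [eval, hstate₂]
    · simp [eval, hlayer₂]
    · intro p hp
      rw [valTable_of_lt ℓ w hp.2]
      simp [eval, hframe.arr aVal (by decide), h.arr_val]
    · simp [Set.EqOn]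
    · simp [Set.EqOn]
    · intro q hq
      rw [bestTable_of_lt ℓ w hq.2]
      exact hbest₂ hq
  · simp [eval, f₂.reg rVoter (by decide), hvoter]
  · simp [eval, hframe.reg rVotes (by decide), h.reg_votes]

variable (ℓ m n K w) in
/-- The assignment `g` has been written down for the voters from `i` on, and the rest of it is the
trace of the current state. -/
structure Traced (g : ℕ → ℕ) (i : ℕ) (s : Mem) : Prop where
  reg_voter : s.reg rVoter = i
  out : Set.EqOn (s.arr aOut) g (Set.Ico i n)
  state : ∃ t < K, ∃ c < m, s.reg rState = flat m K i t c ∧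
    Set.EqOn (dpTrace ℓ m w i t c) g (Set.Iio i)

theorem Traced.runs_traceStep {g : ℕ → ℕ} {j : ℕ} (h : Traced ℓ m n K w g (i + 1) s)
    (hi : i < n) (hone : s.reg rOne = 1) (hrank : s.reg rRank = j)
    (hpred : Set.EqOn (s.arr aPred) (predTable ℓ m K w) (Set.Ico (K * m) ((n + 1) * K * m)))
    (hcand : Set.EqOn (s.arr aCand) (· % m) (Set.Ico (K * m) ((n + 1) * K * m))) :
    traceStep.Runs s 5 fun s' => s'.reg rRank = j + 1 ∧ Traced ℓ m n K w g i s' := by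
  obtain ⟨t, ht, c, hc, hstate, htrace⟩ := h.state
  have hmem : flat m K (i + 1) t c ∈ Set.Ico (K * m) ((n + 1) * K * m) := by
    have hle : (i + 2) * K ≤ (n + 1) * K := Nat.mul_le_mul_right K (by omega)
    refine ⟨le_add_right (Nat.mul_le_mul_right m ?_), flat_lt_of_lt (t' := 0) (i + 1) 0 ?_ hc⟩
    · exact le_add_right (Nat.le_mul_of_pos_left K i.succ_pos)
    · linarith
  have hcand' : s.arr aCand (s.reg rState) = g i := by
    rw [hstate, hcand hmem, ← htrace i.lt_succ_self, dpTrace, Function.update_self]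
    exact (flat_div_mod (i + 1) t hc).2
  let p := dpPred m (dpTable ℓ m w i) t c
  have hpred' : s.arr aPred (s.reg rState) = flat m K i p.1 p.2 := by
    rw [hstate, hpred hmem, predTable_flat ℓ w i ht hc]
  refine runs_of_isLoopFree rfl le_rfl ⟨by simp [traceStep, eval, hrank, hone], ?_, ?_, ?_⟩
  · simp [traceStep, eval, h.reg_voter, hone]
  · have hout : Set.EqOn (Function.update (s.arr aOut) i (g i)) g (Set.Ico i n) := by
      grind [Set.EqOn, Function.update_apply, h.out]
    simpa [traceStep, eval, h.reg_voter, hone, hcand'] using hout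
  · refine ⟨p.1, (dpPred_fst_le _ _).trans_lt ht, p.2, dpPred_snd_lt _ _ hc, ?_, fun x hx => ?_⟩
    · simp [traceStep, eval, hpred']
    · rw [← htrace (Nat.lt_succ_of_lt hx), dpTrace, Function.update_of_ne (Nat.ne_of_lt hx)]

theorem Env.runs_traceBack (h : Env m n K A X s) (hT : Tables ℓ m K w ((n + 1) * K) 0 s)
    (hm : 0 < m) (hK : 0 < K) (hvoter : s.reg rVoter = n) :
    traceBack.Runs s (6 * n + 5) fun s' => s'.reg rLength = n ∧
      Set.EqOn (s'.arr aOut)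
        (dpTrace ℓ m w n (K - 1) (argminBelow (dpTable ℓ m w n (K - 1)) m)) (Set.Iio n) := by
  set g := dpTrace ℓ m w n (K - 1) (argminBelow (dpTable ℓ m w n (K - 1)) m)
  suffices traceBack.Runs s (3 + (n * (5 + 1) + 1 + 1)) _ from this.mono (by omega) fun _ _ => id
  have hlayer : s.reg rLayer - s.reg rOne = n * K + (K - 1) := by
    rw [hT.reg_layer, h.reg_one, Nat.succ_mul]
    omega
  have hstart : s.arr aBest (n * K + (K - 1)) =
      flat m K n (K - 1) (argminBelow (dpTable ℓ m w n (K - 1)) m) := by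
    rw [← bestTable_layer ℓ w n (by omega)]
    exact hT.best ⟨Nat.zero_le _, by rw [Nat.succ_mul]; omega⟩
  refine (runs_of_isLoopFree rfl le_rfl (Q := fun s' => s'.reg rRank = 0 ∧
    Traced ℓ m n K w g n s') ⟨by simp [eval], ?_, ?_, ?_⟩).seq fun s₁ f₁ ⟨hrank₁, htraced₁⟩ => ?_
  · simp [eval, hvoter]
  · simp [Set.EqOn]
  · refine ⟨K - 1, by omega, _, argminBelow_lt _ hm, ?_, Set.eqOn_refl _ _⟩
    simp [eval, hlayer, hstart]
  have h₁ := h.of_frame f₁ (by decide) (by decide)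
  refine (Runs.forLT (fun j s' => Traced ℓ m n K w g (n - j) s') (by decide) h₁.reg_n hrank₁
    htraced₁ fun j hj s' f hrank htraced => ?_).seq fun s₂ f₂ htraced₂ => ?_
  · have hpred : s'.arr aPred = s.arr aPred := by rw [f.arr _ (by decide), f₁.arr _ (by decide)]
    have hcand : s'.arr aCand = s.arr aCand := by rw [f.arr _ (by decide), f₁.arr _ (by decide)]
    rw [show n - j = n - (j + 1) + 1 by omega] at htraced
    exact htraced.runs_traceStep (by omega) ((f.reg _ (by decide)).trans h₁.reg_one) hrank
      (hpred ▸ hT.pred) (hcand ▸ hT.cand)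
  have h₂ := h₁.of_frame f₂ (by decide) (by decide)
  have hout := htraced₂.out
  rw [Nat.sub_self] at hout
  exact runs_of_isLoopFree rfl le_rfl
    ⟨by simp [eval, h₂.reg_n, h₂.reg_zero], fun x hx => hout ⟨Nat.zero_le x, hx⟩⟩

theorem Ready.runs_core {k : ℕ} (h : Ready m n A X base k s) (hX : Ballots m n A X w base)
    (hm : 0 < m) (hn : 0 < n) (hk : 0 < k) :
    (core ℓ).Runs s (71 * (m * n * min k n)) fun s' => s'.reg rLength = n ∧
      Set.EqOn (s'.arr aOut) (dpTrace ℓ m w n (min k n - 1)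
        (argminBelow (dpTable ℓ m w n (min k n - 1)) m)) (Set.Iio n) := by
  have hK : 0 < min k n := lt_min hk hn
  have hbound : 4 * min k n + 10 + (n * (44 * (m * min k n) + 1) + 1 + (6 * n + 5)) ≤
      71 * (m * n * min k n) := by
    have hmn : 0 < m * n := Nat.mul_pos hm hn
    have hn_le : n ≤ m * n * min k n :=
      (Nat.le_mul_of_pos_left n hm).trans (Nat.le_mul_of_pos_right _ hK)
    linarith [Nat.le_mul_of_pos_left (min k n) hmn, Nat.mul_pos hmn hK]
  suffices (core ℓ).Runs s _ _ from this.mono hbound fun _ _ => id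
  refine (h.runs_initTables (ℓ := ℓ) (w := w)).seq fun s₁ _ ⟨h₁, hT₁, hvoter₁, hvotes₁⟩ => ?_
  refine (Runs.forLT (fun i s' => s'.reg rVoter = i ∧
    Tables ℓ m (min k n) w ((i + 1) * min k n) 0 s' ∧ s'.reg rVotes = base + i * m)
    (by cases ℓ <;> decide) h₁.reg_n hvoter₁
    ⟨hvoter₁, by rwa [zero_add, one_mul], by rw [hvotes₁, zero_mul, add_zero]⟩
    fun i hi s' f hvoter ⟨_, hT, hvotes⟩ => ?_).seq fun s₂ f₂ ⟨hvoter₂, hT₂, _⟩ => ?_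
  · refine ((h₁.of_frame f (by cases ℓ <;> decide) (by cases ℓ <;> decide)).runs_processVoter
      hX hm hi hK hvoter hT hvotes).mono le_rfl fun _ _ => ?_
    rintro ⟨hvoter', hT', hvotes'⟩
    exact ⟨hvoter', hvoter', hT', hvotes'⟩
  · exact (h₁.of_frame f₂ (by cases ℓ <;> decide) (by cases ℓ <;> decide)).runs_traceBack
      hT₂ hm hK hvoter₂

end Correctness

/-! ### Tabulating a family -/

namespace Program

/-- Compute the shifted address of a cell to be written to, from the address in register `x`. -/
def locate (x : ℕ) : Program :=
  seq (add rAddr rOffset x) (ifLT rMax rAddr (add rMax rAddr rZero) skip)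

/-- A copy of a program that leaves the registers below `32` (up to `rMax`, `rAddr`) and the arrays
below `8` to its host and shifts all array addresses by `rOffset`; `rMax` records the largest
address written to, so that all cells beyond it are known to be `0`. -/
def relocate : Program → Program
  | skip => skip
  | const x c => const (x + 32) c
  | add x y z => add (x + 32) (y + 32) (z + 32)
  | sub x y z => sub (x + 32) (y + 32) (z + 32)
  | load x a y => seq (add rAddr rOffset (y + 32)) (load (x + 32) (a + 8) rAddr)
  | store a x y => seq (locate (x + 32)) (store (a + 8) rAddr (y + 32))
  | seq P Q => seq P.relocate Q.relocate
  | ifLT x y P Q => ifLT (x + 32) (y + 32) P.relocate Q.relocate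
  | whileLT x y P => whileLT (x + 32) (y + 32) P.relocate

theorem of_mem_writes_relocate {P : Program} {x : ℕ} (hx : x ∈ P.relocate.writes) :
    x = rMax ∨ x = rAddr ∨ 32 ≤ x := by
  induction P <;> simp only [relocate, locate, writes, Finset.mem_union, Finset.mem_singleton,
    Finset.notMem_empty] at hx <;> grind

theorem le_of_mem_stores_relocate {P : Program} {a : ℕ} (ha : a ∈ P.relocate.stores) : 8 ≤ a := by
  induction P <;> simp only [relocate, locate, stores, Finset.mem_union, Finset.mem_singleton,
    Finset.notMem_empty] at ha <;> grind

/-- Reset the first `b` relocated registers. -/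
def clear : ℕ → Program
  | 0 => skip
  | b + 1 => seq (const (b + 32) 0) (clear b)

theorem le_of_mem_writes_clear {b x : ℕ} (hx : x ∈ (clear b).writes) : 32 ≤ x := by
  induction b with
  | zero => exact absurd hx (Finset.notMem_empty x)
  | succ b ih =>
    rcases Finset.mem_union.1 hx with hx | hx
    · rw [Finset.mem_singleton.1 hx]
      exact Nat.le_add_left _ _
    · exact ih hx

theorem stores_clear (b : ℕ) : (clear b).stores = ∅ := by
  induction b with
  | zero => rfl
  | succ b ih => rw [clear, stores, stores, ih, Finset.union_idempotent]

/-- Write the input `[m, r]` into relocated memory, at the first offset that is still unused, where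
`rM` and `rRank` hold `m` and `r`. A fresh offset makes it unnecessary to clear any array. -/
def placeInput : Program :=
  seq (add rOffset rMax rOne) <|
  seq (add rMax rOffset rOne) <|
  seq (store 8 rOffset rM) <|
  seq (store 8 rMax rRank) (const 32 2)

/-- A strict bound for the registers that a program may write to and the input register `0`. -/
def regBound (P : Program) : ℕ := P.writes.sup id + 1

theorem notMem_writes_of_regBound_le {P : Program} {x : ℕ} (hx : P.regBound ≤ x) :
    x ∉ P.writes :=
  fun hmem => absurd (Finset.le_sup (f := id) hmem) (Nat.not_le.2 hx)

/-- Run a relocated copy of `P` on the input `[m, r]` in clean memory, where `rM` and `rRank` hold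
`m` and `r`. -/
def simulate (P : Program) : Program :=
  seq (clear P.regBound) <| seq placeInput P.relocate

theorem of_mem_writes_simulate {P : Program} {x : ℕ} (hx : x ∈ P.simulate.writes) :
    x = rOffset ∨ x = rMax ∨ x = rAddr ∨ 32 ≤ x := by
  simp only [simulate, placeInput, writes, Finset.mem_union, Finset.mem_singleton,
    Finset.notMem_empty] at hx
  grind [→ le_of_mem_writes_clear, → of_mem_writes_relocate]

theorem le_of_mem_stores_simulate {P : Program} {a : ℕ} (ha : a ∈ P.simulate.stores) : 8 ≤ a := by
  simp only [simulate, placeInput, stores, stores_clear, Finset.mem_union, Finset.mem_singleton,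
    Finset.notMem_empty] at ha
  grind [→ le_of_mem_stores_relocate]

/-- Fill the array `aDissat` with the outputs of `P` on `[m, 0]`, …, `[m, m - 1]`. -/
def tabulate (P : Program) : Program :=
  whileLT rRank rM <|
    seq P.simulate <|
    seq (load rTmp 9 rOffset) <|
    seq (store aDissat rRank rTmp) (add rRank rRank rOne)

theorem of_mem_writes_tabulate {P : Program} {x : ℕ} (hx : x ∈ P.tabulate.writes) :
    rRank ≤ x := by
  simp only [tabulate, writes, Finset.mem_union, Finset.mem_singleton, Finset.notMem_empty] at hx
  grind [→ of_mem_writes_simulate]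

theorem of_mem_stores_tabulate {P : Program} {a : ℕ} (ha : a ∈ P.tabulate.stores) :
    a = aDissat ∨ 8 ≤ a := by
  simp only [tabulate, stores, Finset.mem_union, Finset.mem_singleton, Finset.notMem_empty] at ha
  grind [→ le_of_mem_stores_simulate]

/-- Read the parameters `m`, `n`, `k`. -/
def readParams : Program :=
  seq (const rZero 0) <|
  seq (const rOne 1) <|
  seq (const rRank 0) <|
  seq (const rMax 0) <|
  seq (const rVotes 0) <|
  seq (load rM aIn rVotes) <|
  seq (add rVotes rVotes rOne) <|
  seq (load rN aIn rVotes) <|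
  seq (add rVotes rVotes rOne) <|
  seq (load rK aIn rVotes) (add rVotes rVotes rOne)

/-- Copy the values of the dissatisfaction function from the input. -/
def copyDissat : Program :=
  whileLT rRank rM <|
    seq (load rTmp aIn rVotes) <|
    seq (store aDissat rRank rTmp) <|
    seq (add rVotes rVotes rOne) (add rRank rRank rOne)

end Program

/-- `s'` contains the memory `s` of a program in relocated form. -/
structure Represents (s s' : Mem) : Prop where
  reg : ∀ x, s'.reg (x + 32) = s.reg x
  arr : ∀ a i, s'.arr (a + 8) (s'.reg rOffset + i) = s.arr a i
  beyond : ∀ a i, s'.reg rMax < i → s'.arr (a + 8) i = 0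
  reg_zero : s'.reg rZero = 0

/-- Relocated memory is zero except for the first `b` registers and the cells up to `rMax`. -/
structure Fresh (b : ℕ) (s : Mem) : Prop where
  reg : ∀ x, b ≤ x → s.reg (x + 32) = 0
  beyond : ∀ a i, s.reg rMax < i → s.arr (a + 8) i = 0

/-- The parameters `m`, `n`, `k` of the input `X` have been read. -/
structure Params (m n k : ℕ) (X : ℕ → ℕ) (s : Mem) : Prop where
  reg_m : s.reg rM = m
  reg_n : s.reg rN = n
  reg_k : s.reg rK = k
  reg_zero : s.reg rZero = 0
  reg_one : s.reg rOne = 1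
  arr_input : s.arr aIn = X
  arr_val : ∀ p, s.arr aVal p = 0

section Preparation

open Program

variable {P : Program} {s s' s₁ : Mem} {m n k b r v t : ℕ} {X : ℕ → ℕ}

theorem Represents.setReg (h : Represents s s') (x v : ℕ) :
    Represents (s.setReg x v) (s'.setReg (x + 32) v) where
  reg y := by simp [h.reg]
  arr := by simpa using h.arr
  beyond := by simpa using h.beyond
  reg_zero := by simp [h.reg_zero]

theorem Represents.runs_load (h : Represents s s') (x a y : ℕ) :
    (load x a y).relocate.Runs s' 2 (Represents (s.setReg x (s.arr a (s.reg y)))) := by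
  refine runs_of_isLoopFree rfl le_rfl ⟨fun z => ?_, ?_, ?_, ?_⟩
  · simp [relocate, eval, h.reg, h.arr]
  · simpa [relocate, eval] using h.arr
  · simpa [relocate, eval] using h.beyond
  · simp [relocate, eval, h.reg_zero]

theorem Represents.runs_locate (h : Represents s s') (x : ℕ) :
    (locate (x + 32)).Runs s' 4 fun s'' => Represents s s'' ∧
      s''.reg rAddr = s''.reg rOffset + s.reg x ∧ s''.reg rAddr ≤ s''.reg rMax := by
  have hframe := frame_eval (P := locate (x + 32)) rfl s'
  have hoffset : ((locate (x + 32)).eval s').reg rOffset = s'.reg rOffset :=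
    hframe.reg _ (by simp [locate, writes])
  have haddr : ((locate (x + 32)).eval s').reg rAddr = s'.reg rOffset + s.reg x := by
    by_cases hlt : s'.reg rMax < s'.reg rOffset + s.reg x <;> simp [locate, eval, h.reg, hlt]
  have hmax : ((locate (x + 32)).eval s').reg rMax =
      max (s'.reg rMax) (s'.reg rOffset + s.reg x) := by
    rcases lt_or_ge (s'.reg rMax) (s'.reg rOffset + s.reg x) with hlt | hge
    · simp [locate, eval, h.reg, h.reg_zero, hlt, hlt.le]
    · simp [locate, eval, h.reg, hge, hge.not_gt]
  have harr : ((locate (x + 32)).eval s').arr = s'.arr :=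
    funext fun b => hframe.arr b (by simp [locate, stores])
  refine runs_of_isLoopFree rfl le_rfl
    ⟨⟨fun z => ?_, fun b i => ?_, fun b i hi => ?_, ?_⟩, ?_, ?_⟩
  · rw [hframe.reg _ (by simp [locate, writes]), h.reg]
  · rw [hoffset, harr, h.arr]
  · rw [hmax, max_lt_iff] at hi
    rw [harr, h.beyond _ _ hi.1]
  · rw [hframe.reg _ (by simp [locate, writes]), h.reg_zero]
  · rw [haddr, hoffset]
  · rw [haddr, hmax]
    exact le_max_right _ _

theorem Represents.runs_store (h : Represents s s') (a x y : ℕ) :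
    (store a x y).relocate.Runs s' 5 (Represents (s.setArr a (s.reg x) (s.reg y))) := by
  refine (h.runs_locate x).seq fun s₂ _ ⟨h₂, haddr, hmax⟩ =>
    runs_of_isLoopFree rfl le_rfl ⟨fun z => ?_, fun b i => ?_, fun b i hi => ?_, ?_⟩
  · simp [eval, h₂.reg]
  · by_cases hb : b = a
    · simp [eval, hb, haddr, h₂.arr, h₂.reg, Function.update_apply]
    · simp [eval, hb, h₂.arr]
  · have hne : i ≠ s₂.reg rAddr := (hmax.trans_lt hi).ne'
    have hzero : s₂.arr (b + 8) i = 0 := h₂.beyond b i hi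
    by_cases hb : b = a
    · simpa [eval, hb, hne] using hb ▸ hzero
    · simpa [eval, hb] using hzero
  · simp [eval, h₂.reg_zero]

theorem Represents.runs_relocate (h : Represents s s') (hP : Exec P s s₁ t) :
    P.relocate.Runs s' (5 * t) (Represents s₁) := by
  induction hP generalizing s' with
  | skip s => exact ⟨s', 1, .skip s', by omega, h⟩
  | const s x c => exact ⟨_, 1, .const s' _ c, by omega, h.setReg x c⟩
  | add s x y z => exact ⟨_, 1, .add s' _ _ _, by omega, by rw [h.reg, h.reg]; exact h.setReg x _⟩
  | sub s x y z => exact ⟨_, 1, .sub s' _ _ _, by omega, by rw [h.reg, h.reg]; exact h.setReg x _⟩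
  | load s x a y => exact (h.runs_load x a y).mono (by omega) fun _ _ => id
  | store s a x y => exact h.runs_store a x y
  | seq _ _ ihP ihQ => exact ((ihP h).seq fun _ _ => ihQ).mono (by omega) fun _ _ => id
  | ifTrue hlt _ ih =>
    obtain ⟨s₂, u, hE, hu, h₂⟩ := ih h
    exact ⟨s₂, u + 1, .ifTrue (by rwa [h.reg, h.reg]) hE, by omega, h₂⟩
  | ifFalse hlt _ ih =>
    obtain ⟨s₂, u, hE, hu, h₂⟩ := ih h
    exact ⟨s₂, u + 1, .ifFalse (by rwa [h.reg, h.reg]) hE, by omega, h₂⟩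
  | whileTrue hlt _ _ ihP ihW =>
    obtain ⟨s₂, u, hE, hu, h₂⟩ := ihP h
    obtain ⟨s₃, u', hW, hu', h₃⟩ := ihW h₂
    exact ⟨s₃, u + u' + 1, .whileTrue (by rwa [h.reg, h.reg]) hE hW, by omega, h₃⟩
  | whileFalse hlt => exact ⟨s', 1, .whileFalse (by rwa [h.reg, h.reg]), by omega, h⟩

theorem Fresh.runs_clear (h : Fresh b s) : (clear b).Runs s (b + 1) (Fresh 0) := by
  induction b generalizing s with
  | zero => exact ⟨s, 1, .skip s, le_rfl, h⟩
  | succ b ih =>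
    refine Runs.mono (B := 1 + (b + 1)) (Runs.seq (Q := Fresh b) ?_ fun _ _ => ih) (by omega)
      fun _ _ => id
    refine runs_of_isLoopFree rfl le_rfl ⟨fun x hx => ?_, ?_⟩
    · rcases hx.eq_or_lt with rfl | hlt
      · simp [eval]
      · simpa [eval, hlt.ne'] using h.reg x hlt
    · simpa [eval] using h.beyond

theorem Fresh.runs_placeInput (h : Fresh 0 s) (hm : s.reg rM = m) (hr : s.reg rRank = r)
    (hone : s.reg rOne = 1) (hzero : s.reg rZero = 0) :
    placeInput.Runs s 5 (Represents (Mem.init [m, r])) := by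
  have harr : (placeInput.eval s).arr 8 = Function.update
      (Function.update (s.arr 8) (s.reg rMax + 1) m) (s.reg rMax + 1 + 1) r := by
    simp [placeInput, eval, hone, hm, hr]
  have harr' (a : ℕ) (ha : a ≠ 0) : (placeInput.eval s).arr (a + 8) = s.arr (a + 8) := by
    simp [placeInput, eval, ha]
  refine runs_of_isLoopFree rfl le_rfl ⟨fun x => ?_, fun a i => ?_, fun a i hi => ?_, ?_⟩
  · simp [placeInput, eval, Mem.init, h.reg]
  · have hoffset : (placeInput.eval s).reg rOffset = s.reg rMax + 1 := by
      simp [placeInput, eval, hone]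
    have hbeyond := h.beyond a (s.reg rMax + 1 + i) (by omega)
    rw [hoffset]
    rcases eq_or_ne a 0 with rfl | ha
    · rw [harr]
      rcases i with _ | _ | i <;> grind [Mem.init]
    · simp [harr' a ha, hbeyond, Mem.init, ha]
  · have hmax : (placeInput.eval s).reg rMax = s.reg rMax + 1 + 1 := by
      simp [placeInput, eval, hone]
    have hbeyond := h.beyond a i (by omega)
    rcases eq_or_ne a 0 with rfl | ha
    · rw [zero_add] at hbeyond ⊢
      rw [harr, Function.update_of_ne (by omega), Function.update_of_ne (by omega), hbeyond]
    · rw [harr' a ha, hbeyond]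
  · simp [placeInput, eval, hzero]

theorem Fresh.runs_simulate (h : Fresh P.regBound s) (hm : s.reg rM = m) (hr : s.reg rRank = r)
    (hone : s.reg rOne = 1) (hzero : s.reg rZero = 0) (hP : P.Outputs [m, r] [v] t) :
    P.simulate.Runs s (P.regBound + 1 + (5 + 5 * t)) fun s' =>
      s'.arr 9 (s'.reg rOffset) = v ∧ Fresh P.regBound s' := by
  obtain ⟨s₁, hE, hout⟩ := hP
  have hlen : s₁.reg 1 = 1 := by simpa [Mem.output] using congrArg List.length hout
  have hval : s₁.arr 1 0 = v := by simpa [Mem.output, hlen] using hout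
  have hhigh (x : ℕ) (hx : P.regBound ≤ x) : s₁.reg x = 0 := by
    rw [(frame_of_exec hE).reg x (notMem_writes_of_regBound_le hx)]
    exact if_neg (Nat.ne_of_gt (Nat.zero_lt_of_lt hx))
  refine h.runs_clear.seq fun s₂ f₂ h₂ => ?_
  have hreg (x : ℕ) (hx : x < 32) : s₂.reg x = s.reg x :=
    f₂.reg x fun hmem => hx.not_ge (le_of_mem_writes_clear hmem)
  refine (h₂.runs_placeInput (by rw [hreg _ (by decide), hm]) (by rw [hreg _ (by decide), hr])
    (by rw [hreg _ (by decide), hone]) (by rw [hreg _ (by decide), hzero])).seq fun s₃ _ h₃ =>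
      (h₃.runs_relocate hE).mono le_rfl fun s₄ _ h₄ => ⟨?_, fun x hx => ?_, h₄.beyond⟩
  · exact (h₄.arr 1 0).trans hval
  · rw [h₄.reg, hhigh x hx]

theorem runs_tabulate {a : ℕ → ℕ} {B : ℕ} (hP : ∀ r < m, ∃ t ≤ B, P.Outputs [m, r] [a r] t)
    (h : Params m n k X s) (hr : s.reg rRank = 0) (hfresh : Fresh 0 s) :
    P.tabulate.Runs s (m * (P.regBound + 5 * B + 10) + 1) fun s' =>
      Set.EqOn (s'.arr aDissat) a (Set.Iio m) := by
  have hfresh' : Fresh P.regBound s := ⟨fun x _ => hfresh.reg x (Nat.zero_le x), hfresh.beyond⟩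
  refine (Runs.forLT (B := P.regBound + 1 + (5 + 5 * B) + 3)
    (fun r s' => Fresh P.regBound s' ∧ Set.EqOn (s'.arr aDissat) a (Set.Iio r)) ?_ h.reg_m hr
    ⟨hfresh', by simp⟩ fun r hrm s₁ f₁ hr₁ ⟨h₁, hdissat₁⟩ => ?_).mono ?_ fun _ _ h => h.2
  · exact fun hmem => absurd (of_mem_writes_tabulate hmem) (by decide)
  · obtain ⟨t, ht, hout⟩ := hP r hrm
    have hreg (x : ℕ) (hx : x < rRank) : s₁.reg x = s.reg x :=
      f₁.reg x fun hmem => hx.not_ge (of_mem_writes_tabulate hmem)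
    have hone : s₁.reg rOne = 1 := by rw [hreg _ (by decide), h.reg_one]
    refine ((h₁.runs_simulate (by rw [hreg _ (by decide), h.reg_m]) hr₁ hone
      (by rw [hreg _ (by decide), h.reg_zero]) hout).mono (by omega) fun _ _ => id).seq
      fun s₂ f₂ ⟨hval₂, h₂⟩ => ?_
    have hreg₂ (x : ℕ) (hx : x < rOffset) : s₂.reg x = s₁.reg x :=
      f₂.reg x fun hmem => by have := of_mem_writes_simulate hmem; omega
    have hdissat₂ : s₂.arr aDissat = s₁.arr aDissat :=
      f₂.arr _ fun hmem => absurd (le_of_mem_stores_simulate hmem) (by decide)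
    have hr₂ : s₂.reg rRank = r := by rw [hreg₂ _ (by decide), hr₁]
    refine runs_of_isLoopFree rfl le_rfl ⟨?_, ⟨fun x hx => ?_, ?_⟩, fun x hx => ?_⟩
    · simp [eval, hr₂, hreg₂, hone]
    · have hx0 : x ≠ 0 := Nat.ne_of_gt (Nat.zero_lt_of_lt hx)
      simpa [eval, hx0] using h₂.reg x hx
    · simpa [eval] using h₂.beyond
    · rcases (Nat.le_of_lt_succ hx).eq_or_lt with rfl | hlt
      · simp [eval, hr₂, hval₂]
      · simpa [eval, hr₂, hlt.ne, hdissat₂] using hdissat₁ hlt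
  · exact Nat.add_le_add_right (Nat.mul_le_mul_left _ (by omega)) 1

theorem runs_readParams (l : List ℕ) :
    readParams.Runs (Mem.init (m :: n :: k :: l)) 11 fun s =>
      Params m n k (fun i => (m :: n :: k :: l).getD i 0) s ∧ s.reg rVotes = 3 ∧
        s.reg rRank = 0 ∧ Fresh 0 s := by
  refine runs_of_isLoopFree rfl le_rfl ⟨?_, rfl, rfl, ?_, ?_⟩
  · constructor <;> simp [readParams, eval, Mem.init]
  · simp [readParams, eval, Mem.init]
  · simp [readParams, eval, Mem.init]

theorem runs_copyDissat (h : Params m n k X s) (hvotes : s.reg rVotes = b)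
    (hr : s.reg rRank = 0) :
    copyDissat.Runs s (m * 5 + 1) fun s' =>
      s'.reg rVotes = b + m ∧ Set.EqOn (s'.arr aDissat) (fun r => X (b + r)) (Set.Iio m) := by
  refine Runs.forLT (fun r s' => s'.reg rVotes = b + r ∧
    Set.EqOn (s'.arr aDissat) (fun r => X (b + r)) (Set.Iio r)) (by decide) h.reg_m hr
    ⟨hvotes, by simp⟩ fun r _ s₁ f₁ hr₁ ⟨hvotes₁, hdissat₁⟩ => ?_
  have hone : s₁.reg rOne = 1 := by rw [f₁.reg _ (by decide), h.reg_one]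
  have hin : s₁.arr aIn = X := by rw [f₁.arr _ (by decide), h.arr_input]
  refine runs_of_isLoopFree rfl le_rfl ⟨?_, ?_, fun x hx => ?_⟩
  · simp [eval, hr₁, hone]
  · simp [eval, hvotes₁, hone, add_assoc]
  · rcases (Nat.le_of_lt_succ hx).eq_or_lt with rfl | hlt
    · simp [eval, hr₁, hvotes₁, hin]
    · simpa [eval, hr₁, hlt.ne] using hdissat₁ hlt

end Preparation

/-! ### Encodings -/

namespace Election

theorem encodeVotes_eq_ofFn (E : Election) :
    E.encodeVotes = List.ofFn fun p : Fin (E.n * E.m) => (E.vote p.divNat p.modNat : ℕ) := by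
  have hcode (i : Fin E.n) (r : Fin E.m) (hlt : i * E.m + r < E.n * E.m) :
      ⟨i * E.m + r, hlt⟩ = Fin.mkDivMod i r :=
    Fin.ext (congrArg (· + (r : ℕ)) (Nat.mul_comm _ _))
  simp only [encodeVotes, List.ofFn_mul, hcode, Fin.divNat_mkDivMod, Fin.modNat_mkDivMod]

theorem length_encodeVotes (E : Election) : E.encodeVotes.length = E.n * E.m := by
  rw [encodeVotes_eq_ofFn, List.length_ofFn]

theorem getD_encodeVotes (E : Election) (i : Fin E.n) (r : Fin E.m) :
    E.encodeVotes.getD (i * E.m + r) 0 = E.vote i r := by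
  have hlt : E.m * i + r < E.n * E.m := (Fin.mkDivMod i r).isLt
  rw [encodeVotes_eq_ofFn, Nat.mul_comm i, List.getD_eq_getElem _ _ (by rwa [List.length_ofFn]),
    List.getElem_ofFn]
  change (E.vote (Fin.mkDivMod i r).divNat (Fin.mkDivMod i r).modNat : ℕ) = E.vote i r
  rw [Fin.divNat_mkDivMod, Fin.modNat_mkDivMod]

end Election

theorem length_le_bitLength (l : List ℕ) : l.length ≤ bitLength l := by
  simp [bitLength, List.sum_map_add]

namespace Election

theorem m_le_bitLength (E : Election) (k : ℕ) : E.m ≤ bitLength (E.encode k) := by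
  refine le_trans ?_ (length_le_bitLength _)
  rw [encode, List.length_append, E.length_encodeVotes]
  exact le_add_left (Nat.le_mul_of_pos_left E.m E.n_pos)

theorem n_le_bitLength (E : Election) (k : ℕ) : E.n ≤ bitLength (E.encode k) := by
  refine le_trans ?_ (length_le_bitLength _)
  rw [encode, List.length_append, E.length_encodeVotes]
  exact le_add_left (Nat.le_mul_of_pos_right E.n E.m_pos)

theorem mul_min_le_bitLength_pow (E : Election) (k : ℕ) :
    E.m * E.n * min k E.n ≤ bitLength (E.encode k) ^ 3 := by
  have hn := E.n_le_bitLength k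
  calc E.m * E.n * min k E.n ≤ _ :=
        Nat.mul_le_mul (Nat.mul_le_mul (E.m_le_bitLength k) hn) ((min_le_right _ _).trans hn)
    _ = bitLength (E.encode k) ^ 3 := (pow_three' _).symm

end Election

theorem output_eq_encodeAssignment {n m : ℕ} {s : Mem} (Φ : Fin n → Fin m)
    (hlen : s.reg rLength = n)
    (h : ∀ i : Fin n, s.arr aOut i = Φ i) : s.output = encodeAssignment Φ := by
  rw [Mem.output, encodeAssignment, hlen, ← List.map_coe_finRange_eq_range, List.map_map,
    List.ofFn_eq_map]
  exact List.map_congr_left fun i _ => h i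

/-! ### The algorithms -/

section Algorithms

open Program

theorem Election.ballots {E : Election} {α : Fin E.m → ℕ} {A X : ℕ → ℕ} {base : ℕ}
    (hA : ∀ r : Fin E.m, A r = α r)
    (hX : ∀ (i : Fin E.n) (r : Fin E.m), X (base + i * E.m + r) = E.vote i r) :
    Ballots E.m E.n A X (E.cost α) base where
  cost i hi r hr := by
    lift i to Fin E.n using hi
    lift r to Fin E.m using hr
    rw [hA, hX, cost, dif_pos ⟨i.2, Fin.isLt _⟩]
    exact congrArg α ((E.vote i).symm_apply_apply r).symm
  surj i hi c hc := by
    lift i to Fin E.n using hi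
    lift c to Fin E.m using hc
    refine ⟨E.pos i c, Fin.isLt _, ?_⟩
    rw [hX, pos, Equiv.apply_symm_apply]

theorem Params.ready {P : Program} {m n k : ℕ} {X : ℕ → ℕ} {s s' : Mem} (h : Params m n k X s)
    (hf : P.Frame s s') (hwrites : ∀ x ≤ rK, x ∉ P.writes) (hin : aIn ∉ P.stores)
    (hval : aVal ∉ P.stores) : Ready m n (s'.arr aDissat) X (s'.reg rVotes) k s' where
  reg_m := (hf.reg _ (hwrites _ (by decide))).trans h.reg_m
  reg_n := (hf.reg _ (hwrites _ (by decide))).trans h.reg_n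
  reg_k := (hf.reg _ (hwrites _ le_rfl)).trans h.reg_k
  reg_votes := rfl
  arr_dissat := rfl
  arr_input := (hf.arr _ hin).trans h.arr_input
  arr_val := hf.arr _ hval ▸ h.arr_val

theorem Ready.runs_core_election {E : Election} {α : Fin E.m → ℕ} (ℓ : Aggregation)
    {A X : ℕ → ℕ} {base k : ℕ} {s : Mem} (h : Ready E.m E.n A X base k s) (hk : 0 < k)
    (hA : ∀ r : Fin E.m, A r = α r)
    (hX : ∀ (i : Fin E.n) (r : Fin E.m), X (base + i * E.m + r) = E.vote i r) :
    (core ℓ).Runs s (71 * (E.m * E.n * min k E.n)) fun s' =>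
      s'.output = encodeAssignment (E.solution α ℓ (min k E.n - 1)) :=
  (h.runs_core (Election.ballots hA hX) E.m_pos E.n_pos hk).mono le_rfl
    fun _ _ ⟨hlen, hout⟩ => output_eq_encodeAssignment _ hlen fun i => hout i.2

/-- The algorithm for the family computed by `P`. -/
def Program.solveFamily (P : Program) (ℓ : Aggregation) : Program :=
  seq (seq readParams P.tabulate) (core ℓ)

/-- The algorithm for a dissatisfaction function that is part of the input. -/
def Program.solve (ℓ : Aggregation) : Program :=
  seq (seq readParams copyDissat) (core ℓ)

theorem outputs_solveFamily (ℓ : Aggregation) {E : Election} {α : Fin E.m → ℕ} {P : Program}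
    {B k : ℕ} (hP : ∀ r : Fin E.m, ∃ t ≤ B, P.Outputs [E.m, r] [α r] t) (hk : 0 < k) :
    ∃ t ≤ 11 + (E.m * (P.regBound + 5 * B + 10) + 1) + 71 * (E.m * E.n * min k E.n),
      (P.solveFamily ℓ).Outputs (E.encode k)
        (encodeAssignment (E.solution α ℓ (min k E.n - 1))) t := by
  refine (Runs.seq (Q := fun s => ∃ A, Ready E.m E.n A (fun i => (E.encode k).getD i 0) 3 k s ∧
    ∀ r : Fin E.m, A r = α r) ?_ fun s _ ⟨A, h, hA⟩ =>
      h.runs_core_election ℓ hk hA fun i r => ?_).outputs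
  · refine (runs_readParams E.encodeVotes).seq fun s₁ _ ⟨h₁, hvotes₁, hrank₁, hfresh₁⟩ => ?_
    refine (runs_tabulate (a := fun r => if h : r < E.m then α ⟨r, h⟩ else 0)
      (fun r hr => ?_) h₁ hrank₁ hfresh₁).mono le_rfl fun s₂ f₂ hA => ?_
    · simpa only [dif_pos hr] using hP ⟨r, hr⟩
    · have hwrites (x : ℕ) (hx : x < rRank) : x ∉ P.tabulate.writes :=
        fun hmem => hx.not_ge (of_mem_writes_tabulate hmem)
      have h₂ := h₁.ready f₂ (fun x hx => hwrites x (hx.trans_lt (by decide)))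
        (fun hmem => absurd (of_mem_stores_tabulate hmem) (by decide))
        (fun hmem => absurd (of_mem_stores_tabulate hmem) (by decide))
      rw [f₂.reg _ (hwrites _ (by decide)), hvotes₁] at h₂
      exact ⟨_, h₂, fun r => (hA r.2).trans (dif_pos r.2)⟩
  · rw [← E.getD_encodeVotes i r, add_assoc, Nat.add_comm 3]
    rfl

theorem outputs_solve (ℓ : Aggregation) (E : Election) (α : Fin E.m → ℕ) {k : ℕ}
    (hk : 0 < k) :
    ∃ t ≤ 11 + (E.m * 5 + 1) + 71 * (E.m * E.n * min k E.n),
      (solve ℓ).Outputs (E.encodeWith α k)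
        (encodeAssignment (E.solution α ℓ (min k E.n - 1))) t := by
  refine (Runs.seq (Q := fun s => ∃ A, Ready E.m E.n A (fun i => (E.encodeWith α k).getD i 0)
    (3 + E.m) k s ∧ ∀ r : Fin E.m, A r = α r) ?_ fun s _ ⟨A, h, hA⟩ =>
      h.runs_core_election ℓ hk hA fun i r => ?_).outputs
  · refine (runs_readParams (List.ofFn α ++ E.encodeVotes)).seq
      fun s₁ _ ⟨h₁, hvotes₁, hrank₁, _⟩ => ?_
    refine (runs_copyDissat h₁ hvotes₁ hrank₁).mono le_rfl fun s₂ f₂ ⟨hvotes₂, hA⟩ => ?_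
    have h₂ := h₁.ready f₂ (by decide) (by decide) (by decide)
    rw [hvotes₂] at h₂
    refine ⟨_, h₂, fun r => (hA r.2).trans ?_⟩
    simp [Nat.add_comm 3, List.getD, List.getElem?_append_left]
  · rw [show 3 + E.m + i * E.m + r = E.m + (i * E.m + r) + 3 by omega]
    simp only [Election.encodeWith, List.cons_append, List.nil_append, List.getD_cons_succ]
    rw [List.getD_append_right _ _ _ _ (by simp), List.length_ofFn, Nat.add_sub_cancel_left,
      E.getD_encodeVotes]

end Algorithms

theorem polynomial_eval_mono (p : Polynomial ℕ) : Monotone fun x => p.eval x := by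
  intro a b h
  simp only [Polynomial.eval_eq_sum_range]
  gcongr

theorem mul_min_le {m n k : ℕ} (hn : 0 < n) : m * n * min k n ≤ m * n ^ 2 * k := by
  calc m * n * min k n ≤ m * n * (n * k) := by
        gcongr
        exact (min_le_left k n).trans (Nat.le_mul_of_pos_left k hn)
    _ = m * n ^ 2 * k := by ring

end SCElection

theorem theorem2_general (ℓ : SCElection.Aggregation) :
    (∀ α : (m : ℕ) → Fin m → ℕ, (∀ m, Monotone (α m)) → SCElection.PolyTimeFamily α →
      ∃ (P : SCElection.Program) (p q : Polynomial ℕ) (K : ℕ),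
        ∀ (E : SCElection.Election) (k : ℕ), E.SingleCrossing → 0 < k →
          ∃ (Φ : Fin E.n → Fin E.m) (t : ℕ),
            E.IsOptimalCC (α E.m) ℓ k Φ ∧
            P.Outputs (E.encode k) (SCElection.encodeAssignment Φ) t ∧
            t ≤ p.eval (SCElection.bitLength (E.encode k)) ∧
            t ≤ K * (E.m * E.n * min k E.n) + q.eval E.m) ∧
    (∃ (Q : SCElection.Program) (K : ℕ),
      ∀ (E : SCElection.Election) (α : Fin E.m → ℕ) (k : ℕ),
        E.SingleCrossing → Monotone α → 0 < k →
          ∃ (Φ : Fin E.n → Fin E.m) (t : ℕ),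
            E.IsOptimalCC α ℓ k Φ ∧
            Q.Outputs (E.encodeWith α k) (SCElection.encodeAssignment Φ) t ∧
            t ≤ K * (E.m * E.n * min k E.n)) := by
  have hsucc (E : SCElection.Election) {k : ℕ} (hk : 0 < k) : min k E.n = min k E.n - 1 + 1 :=
    (Nat.succ_pred_eq_of_pos (lt_min hk E.n_pos)).symm
  refine ⟨fun α hα ⟨P, p, hP⟩ => ?_, .solve ℓ, 88, fun E α k hE hα hk => ?_⟩
  · obtain ⟨q, hq⟩ : ∃ q : Polynomial ℕ,
        ∀ x, q.eval x = x * (P.regBound + 5 * p.eval x + 10) + 12 :=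
      ⟨.X * (.C P.regBound + 5 * p + 10) + 12, by simp⟩
    refine ⟨P.solveFamily ℓ, 71 * .X ^ 3 + q, q, 71, fun E k hE hk => ?_⟩
    obtain ⟨t, ht, hout⟩ := SCElection.outputs_solveFamily ℓ (hP E.m) hk
    have htime : t ≤ 71 * (E.m * E.n * min k E.n) + q.eval E.m := by
      rw [hq]
      exact ht.trans (by omega)
    refine ⟨_, t, hE.isOptimalCC_solution (hα E.m) ℓ (hsucc E hk), hout, htime.trans ?_, htime⟩
    simpa using Nat.add_le_add (Nat.mul_le_mul_left 71 (E.mul_min_le_bitLength_pow k))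
      (SCElection.polynomial_eval_mono q (E.m_le_bitLength k))
  · obtain ⟨t, ht, hout⟩ := SCElection.outputs_solve ℓ E α hk
    refine ⟨_, t, hE.isOptimalCC_solution hα ℓ (hsucc E hk), hout, ht.trans ?_⟩
    have hpos : 0 < E.n * min k E.n := Nat.mul_pos E.n_pos (lt_min hk E.n_pos)
    linarith [Nat.le_mul_of_pos_right E.m hpos, E.m_pos]

theorem theorem2 (ℓ : SCElection.Aggregation) :
    -- for every polynomial-time computable family: a polynomial-time algorithm, which moreover
    -- spends `O(m n² k)` steps apart from a time polynomial in `m` for evaluating the family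
    (∀ α : (m : ℕ) → Fin m → ℕ, (∀ m, SCElection.IsDissatisfaction (α m)) →
      SCElection.PolyTimeFamily α →
      ∃ (P : SCElection.Program) (p q : Polynomial ℕ) (K : ℕ),
        ∀ (E : SCElection.Election) (k : ℕ), E.SingleCrossing → 0 < k →
          ∃ (Φ : Fin E.n → Fin E.m) (t : ℕ),
            E.IsOptimalCC (α E.m) ℓ k Φ ∧
            P.Outputs (E.encode k) (SCElection.encodeAssignment Φ) t ∧
            t ≤ p.eval (SCElection.bitLength (E.encode k)) ∧
            t ≤ K * (E.m * E.n ^ 2 * k) + q.eval E.m) ∧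
    -- when the `m` values of the dissatisfaction function are given: time `O(m n² k)`
    (∃ (Q : SCElection.Program) (K : ℕ),
      ∀ (E : SCElection.Election) (α : Fin E.m → ℕ) (k : ℕ),
        E.SingleCrossing → SCElection.IsDissatisfaction α → 0 < k →
          ∃ (Φ : Fin E.n → Fin E.m) (t : ℕ),
            E.IsOptimalCC α ℓ k Φ ∧
            Q.Outputs (E.encodeWith α k) (SCElection.encodeAssignment Φ) t ∧
            t ≤ K * (E.m * E.n ^ 2 * k)) := by
  obtain ⟨h₁, Q, K, h₂⟩ := theorem2_general ℓ
  refine ⟨fun α hα hP => ?_, Q, K, fun E α k hE hα hk => ?_⟩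
  · obtain ⟨P, p, q, K, h⟩ := h₁ α (fun m => (hα m).1) hP
    refine ⟨P, p, q, K, fun E k hE hk => ?_⟩
    obtain ⟨Φ, t, hΦ, hout, hp, hq⟩ := h E k hE hk
    exact ⟨Φ, t, hΦ, hout, hp, hq.trans (by gcongr _ * ?_ + _; exact SCElection.mul_min_le E.n_pos)⟩
  · obtain ⟨Φ, t, hΦ, hout, ht⟩ := h₂ E α k hE hα.1 hk
    exact ⟨Φ, t, hΦ, hout, ht.trans (Nat.mul_le_mul_left K (SCElection.mul_min_le E.n_pos))⟩
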